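/- Let $d\ge 1$ and let $k$ be an integer with $1\le k\le 2d$. Let $\mathbb{L}^d=(\mathbb{Z}^d,\mathcal{E}^d)$ be the hypercubic lattice with nearest-neighbour edges, and let $(U_e)_{e\in\mathcal{E}^d}$ be i.i.d. random variables, uniform on $[0,1]$, with joint law $\mathbb{P}$. In constrained-degree percolation with constraint $k$ all edges are closed at time $0$; an edge $e=\langle u,v\rangle$ opens at time $U_e$ if at every time $s<U_e$ both $u$ and $v$ are incident to fewer than $k$ open edges, and otherwise it never opens; once open, an edge remains open. For $t\in[0,1]$ write $x\leftrightarrow y$ at time $t$ if $x$ and $y$ are joined by a path of edges that are open at time $t$, let $\theta(t)$ be the probability that the set of vertices $y$ with $0\leftrightarrow y$ at time $t$ is infinite, and let $\tau_t(x,y)=\mathbb{P}(x\leftrightarrow y\text{ at time }t)$. Theorem. For every $t\in[0,1]$, if $\theta(t)>0$, then $$\inf_{x,y\in\mathbb{Z}^d}\tau_t(x,y)>0.$$ -/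

import Mathlib

open MeasureTheory Set

namespace CDP

/-- The hypercubic lattice `𝕃^d`: vertex set `ℤ^d`, with an edge between two sites exactly when
their `ℓ¹`-distance is `1`. -/
def lattice (d : ℕ) : SimpleGraph (Fin d → ℤ) where
  Adj x y := ∑ i, |x i - y i| = 1
  symm := ⟨fun x y h => by simpa only [abs_sub_comm] using h⟩
  loopless := ⟨fun x h => by simp at h⟩

/-- The edges of `𝕃^d`. -/
abbrev Edge (d : ℕ) : Type := (lattice d).edgeSet

/-- A collection of clocks `U ∈ [0,1]^{ℰ^d}`. -/
abbrev Clocks (d : ℕ) : Type := Edge d → unitInterval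

/-- The law of i.i.d. clocks, uniform on `[0,1]`. -/
noncomputable def clockMeasure (d : ℕ) : Measure (Clocks d) :=
  Measure.infinitePi (fun _ : Edge d => (volume : Measure unitInterval))

instance (d : ℕ) : IsProbabilityMeasure (clockMeasure d) := by
  unfold clockMeasure; infer_instance

/-- If `O` is the set of edges that ever open, `degreeAt U O s v` is the number of edges at the
site `v` that are open at time `s`: the edges `f ∈ O` at `v` whose clock has rung by time `s`. -/
noncomputable def degreeAt {d : ℕ} (U : Clocks d) (O : Set (Edge d)) (s : unitInterval)
    (v : Fin d → ℤ) : ℕ∞ :=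
  {f : Edge d | v ∈ f.1 ∧ f ∈ O ∧ U f ≤ s}.encard

/-- `O` obeys the constrained-degree dynamics driven by the clocks `U` with constraint `k`:
an edge `e` opens (necessarily at time `U e`, and then forever) if and only if at every time
`s < U e` both of its end-vertices have degree smaller than `k`. -/
def IsEvolution {d : ℕ} (k : ℕ) (U : Clocks d) (O : Set (Edge d)) : Prop :=
  ∀ e : Edge d, e ∈ O ↔ ∀ s < U e, ∀ v ∈ e.1, degreeAt U O s v < k

/-- The edges that are open at time `t`. For almost every `U` there is exactly one set `O`
obeying the dynamics (see `existsUnique_isEvolution`), so that this is `{e ∈ O | U e ≤ t}`. -/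
def openEdges {d : ℕ} (k : ℕ) (U : Clocks d) (t : unitInterval) : Set (Edge d) :=
  {e | ∃ O, IsEvolution k U O ∧ e ∈ O ∧ U e ≤ t}

/-- The subgraph of `𝕃^d` formed by the edges that are open at time `t`. -/
def openGraph {d : ℕ} (k : ℕ) (U : Clocks d) (t : unitInterval) : SimpleGraph (Fin d → ℤ) :=
  SimpleGraph.fromEdgeSet (Subtype.val '' openEdges k U t)

/-- The open cluster of `x` at time `t`. -/
def cluster {d : ℕ} (k : ℕ) (U : Clocks d) (t : unitInterval) (x : Fin d → ℤ) :
    Set (Fin d → ℤ) :=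
  {y | (openGraph k U t).Reachable x y}

/-- The percolation function `θ(t) = ℙ(0 ↔ ∞ at time t)`. -/
noncomputable def theta (d k : ℕ) (t : unitInterval) : ℝ :=
  (clockMeasure d).real {U | (cluster k U t 0).Infinite}

/-- The two-point connectivity function `τ_t(x,y) = ℙ(x ↔ y at time t)`. -/
noncomputable def tau (d k : ℕ) (t : unitInterval) (x y : Fin d → ℤ) : ℝ :=
  (clockMeasure d).real {U | y ∈ cluster k U t x}

/-- `f` is adjacent to `e` and its clock rings before that of `e`. -/
def Precedes {d : ℕ} (U : Clocks d) (f e : Edge d) : Prop :=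
  (∃ v, v ∈ f.1 ∧ v ∈ e.1) ∧ U f < U e

/-- If there is no infinite chain of successively adjacent edges with decreasing clocks (which has
probability one), then exactly one set of edges obeys the dynamics. -/
theorem existsUnique_isEvolution {d : ℕ} (k : ℕ) (U : Clocks d)
    (h : WellFounded (Precedes U)) : ∃! O, IsEvolution k U O := by
  have hex : ∃ O, IsEvolution k U O := by
    refine ⟨{e | h.fix (C := fun _ => Prop) (fun e ih => ∀ s < U e, ∀ v ∈ e.1,
      {f : Edge d | v ∈ f.1 ∧ ∃ hf : Precedes U f e, ih f hf ∧ U f ≤ s}.encard < k) e}, ?_⟩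
    intro e
    rw [mem_ofPred_eq, WellFounded.fix_eq]
    refine forall₂_congr fun s hs => forall₂_congr fun v hv => ?_
    unfold degreeAt
    have : ∀ A B : Set (Edge d), A = B → (A.encard < k ↔ B.encard < k) := by
      rintro A B rfl; rfl
    refine this _ _ ?_
    ext f
    constructor
    · rintro ⟨h1, _, h2, h3⟩
      exact ⟨h1, h2, h3⟩
    · rintro ⟨h1, h2, h3⟩
      exact ⟨h1, ⟨⟨v, h1, hv⟩, h3.trans_lt hs⟩, h2, h3⟩
  have key : ∀ O O' : Set (Edge d), IsEvolution k U O → IsEvolution k U O' → O = O' := by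
    intro O O' hO hO'
    ext e
    induction e using h.induction with
    | _ e ih =>
      rw [hO e, hO' e]
      refine forall₂_congr fun s hs => forall₂_congr fun v hv => ?_
      have : {f : Edge d | v ∈ f.1 ∧ f ∈ O ∧ U f ≤ s} =
          {f : Edge d | v ∈ f.1 ∧ f ∈ O' ∧ U f ≤ s} := by
        ext f
        constructor
        · rintro ⟨h1, h2, h3⟩
          exact ⟨h1, (ih f ⟨⟨v, h1, hv⟩, h3.trans_lt hs⟩).1 h2, h3⟩
        · rintro ⟨h1, h2, h3⟩
          exact ⟨h1, (ih f ⟨⟨v, h1, hv⟩, h3.trans_lt hs⟩).2 h2, h3⟩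
      unfold degreeAt
      rw [this]
  obtain ⟨O, hO⟩ := hex
  exact ⟨O, hO, fun O' hO' => key O' O hO' hO⟩

end CDP

/-! ### Local finiteness of the lattice and almost sure properties of the clocks. -/

namespace CDP

variable {d : ℕ}

/-! The argument has two halves: mixing together with uniqueness of the infinite cluster bounds
`τ_t(0,y)` from below off a finite set, and local modification makes each remaining value positive.

For the first half, the shift acts on i.i.d. clocks, so `ℙ(0 ↔ ∞, y ↔ ∞)` tends to `θ(t)²`
(`mixing`). If two infinite clusters almost surely never coexist, this event forces `0 ↔ y`, so
`τ_t(0,y) ≥ θ(t)²/2` for all but finitely many `y` (`finite_tau_lt`). No correlation inequality is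
needed.

The substitute for finite energy is `surgery`. Resample the clocks of a finite edge set, making the
wanted edges ring before everything nearby and the other edges ring after everything nearby. If the
wanted edges respect the degree constraint and agree with the old configuration near the boundary,
the states at time `t` of all edges outside the set are unchanged. A path has degree at most two, so
`tau_pos` holds once `k ≥ 2`.

Uniqueness is proved by cases. For `k ≥ 3`, non-uniqueness has probability zero or one by mixing. If
it had probability one, a rewiring along a path or a tree of degree three would, with positive
probability, produce either a cluster with three ends or a configuration without two infinite
clusters. The latter is null by assumption, the former by a Burton–Keane count
(`measure_hasThreeEnds`). For `k = 2`, clusters are paths or cycles, and mass transport excludes an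
infinite cluster with an endpoint (`measure_isEndpoint`). In dimension one this forces an infinite
cluster to be the whole line. In dimension at least two, surgery can turn the origin into an
endpoint of an infinite cluster, so `θ(t) = 0` (`measure_infinite_two`). For `k = 1` or `t = 0`
there are no infinite clusters. -/

theorem lattice_adj_mem_Icc {v w : Fin d → ℤ} (h : (lattice d).Adj v w) :
    w ∈ Finset.Icc (v - 1) (v + 1) := by
  have h1 : ∀ i, |v i - w i| ≤ 1 := fun i => by
    have : ∑ i, |v i - w i| = 1 := h
    rw [← this]
    exact Finset.single_le_sum (f := fun i => |v i - w i|) (fun _ _ => abs_nonneg _)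
      (Finset.mem_univ i)
  rw [Finset.mem_Icc]
  constructor <;> intro i <;> have := abs_le.1 (h1 i) <;> simp <;> omega

theorem lattice_neighborSet_finite (v : Fin d → ℤ) : ((lattice d).neighborSet v).Finite :=
  (Finset.Icc (v - 1) (v + 1)).finite_toSet.subset fun _ hw => lattice_adj_mem_Icc hw

/-- The edge with given adjacent end-vertices. -/
def mkEdge {v w : Fin d → ℤ} (h : (lattice d).Adj v w) : Edge d := ⟨s(v, w), h⟩

theorem exists_eq_mkEdge {e : Edge d} {v : Fin d → ℤ} (hv : v ∈ e.1) :
    ∃ w, ∃ h : (lattice d).Adj v w, e = mkEdge h := by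
  obtain ⟨w, hw⟩ := Sym2.mem_iff_exists.1 hv
  refine ⟨w, ?_, Subtype.ext hw⟩
  have := e.2
  rwa [hw] at this

theorem edges_at_finite (v : Fin d → ℤ) : {f : Edge d | v ∈ f.1}.Finite := by
  refine Set.Finite.of_finite_image (f := Subtype.val) ?_ Subtype.val_injective.injOn
  refine ((lattice_neighborSet_finite v).image (fun w => s(v, w))).subset ?_
  rintro _ ⟨f, hf, rfl⟩
  obtain ⟨w, h, rfl⟩ := exists_eq_mkEdge hf
  exact ⟨w, h, rfl⟩

/-- Two edges share an end-vertex. -/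
def Touches (f e : Edge d) : Prop := ∃ v, v ∈ f.1 ∧ v ∈ e.1

theorem touches_finite (e : Edge d) : {f : Edge d | Touches f e}.Finite := by
  have : {f : Edge d | Touches f e} = ⋃ v ∈ {v | v ∈ e.1}, {f : Edge d | v ∈ f.1} := by
    ext f; simp [Touches, and_comm]
  rw [this]
  refine Set.Finite.biUnion ?_ fun v _ => edges_at_finite v
  obtain ⟨⟨a, b⟩, h⟩ := e
  refine (Set.toFinite {a, b}).subset fun v hv => ?_
  simpa using hv

/-- The neighbourhoods of edges can be enumerated with a bounded number of labels. -/
theorem exists_enumeration (d : ℕ) : ∃ (C : ℕ) (nb : Edge d → Fin C → Edge d), 0 < C ∧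
    ∀ e f, Touches f e → ∃ c, nb e c = f := by
  let W : Finset (Fin d → ℤ) := Finset.Icc (-1) 1
  classical
  have hW : ∀ v w : Fin d → ℤ, (lattice d).Adj v w → w - v ∈ W := fun v w h => by
    have := lattice_adj_mem_Icc h
    rw [Finset.mem_Icc] at this ⊢
    constructor <;> intro i <;> have h1 := this.1 i <;> have h2 := this.2 i <;> simp at * <;> omega
  -- A label selects an end-vertex of the edge and a displacement in `{-1,0,1}^d`; a displacement
  -- that is not a lattice step yields the edge itself.
  let T := Bool × W
  let E : T ≃ Fin (Fintype.card T) := Fintype.equivFin T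
  have hend : ∀ e : Edge d, ∃ v : Bool → (Fin d → ℤ), ∀ w, w ∈ e.1 → ∃ b, v b = w := by
    rintro ⟨⟨a, b⟩, h⟩
    refine ⟨fun c => if c then a else b, fun w hw => ?_⟩
    rcases Sym2.mem_iff.1 hw with rfl | rfl
    · exact ⟨true, by simp⟩
    · exact ⟨false, by simp⟩
  choose vs hvs using hend
  refine ⟨Fintype.card T, fun e c => if h : (lattice d).Adj (vs e (E.symm c).1)
    (vs e (E.symm c).1 + (E.symm c).2.1) then mkEdge h else e, ?_, ?_⟩
  · rw [Fintype.card_pos_iff]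
    exact ⟨(true, ⟨0, by simp [W]⟩)⟩
  · rintro e f ⟨v, hvf, hve⟩
    obtain ⟨w, h, rfl⟩ := exists_eq_mkEdge hvf
    obtain ⟨b, rfl⟩ := hvs e v hve
    refine ⟨E (b, ⟨w - vs e b, hW _ _ h⟩), ?_⟩
    simp [h]

/-- The edges visited from `e` by following the labels in a list. -/
def follow {C : ℕ} (nb : Edge d → Fin C → Edge d) : Edge d → List (Fin C) → List (Edge d)
  | e, [] => [e]
  | e, c :: l => e :: follow nb (nb e c) l

theorem exists_follow {C : ℕ} {nb : Edge d → Fin C → Edge d}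
    (hnb : ∀ e f, Touches f e → ∃ c, nb e c = f) (n : ℕ) :
    ∀ f : ℕ → Edge d, (∀ i, Touches (f (i + 1)) (f i)) →
    ∃ l : List (Fin C), l.length = n ∧ follow nb (f 0) l = (List.range (n + 1)).map f := by
  induction n with
  | zero => exact fun f _ => ⟨[], rfl, by simp [follow]⟩
  | succ n ih =>
    intro f hf
    obtain ⟨l, hl, h⟩ := ih (fun i => f (i + 1)) fun i => hf _
    obtain ⟨c, hc⟩ := hnb _ _ (hf 0)
    refine ⟨c :: l, by simp [hl], ?_⟩
    rw [follow, hc]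
    simp only [zero_add] at h
    rw [h, List.range_succ_eq_map (n := n + 1)]
    simp [Function.comp_def]

theorem clockMeasure_forall_mem (s : Finset (Edge d)) {I : Set unitInterval}
    (hI : MeasurableSet I) :
    clockMeasure d {U | ∀ e ∈ s, U e ∈ I} = volume I ^ s.card := by
  have := Measure.infinitePi_pi (fun _ : Edge d => (volume : Measure unitInterval)) (s := s)
    (t := fun _ => I) fun _ _ => hI
  rw [Finset.prod_const] at this
  rw [← this]
  rfl

/-- First-moment bound: at most `C ^ n` label words describe the chains of `n + 1` edges from a
given edge. Injectivity makes the clocks along a chain independent, so each word contributes at most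
`volume I ^ n`. -/
theorem ae_no_path_in {C : ℕ} {nb : Edge d → Fin C → Edge d}
    (hnb : ∀ e f, Touches f e → ∃ c, nb e c = f) {I : Set unitInterval}
    (hI : MeasurableSet I) (hC : C * volume I < 1) :
    ∀ᵐ U ∂clockMeasure d, ¬ ∃ f : ℕ → Edge d, Function.Injective f ∧
      (∀ i, Touches (f (i + 1)) (f i)) ∧ ∀ i, U (f i) ∈ I := by
  classical
  suffices h : ∀ e, clockMeasure d {U | ∃ f : ℕ → Edge d, f 0 = e ∧ Function.Injective f ∧
      (∀ i, Touches (f (i + 1)) (f i)) ∧ ∀ i, U (f i) ∈ I} = 0 by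
    rw [ae_iff]
    refine measure_mono_null ?_ (measure_iUnion_null h)
    intro U hU
    simp only [not_not] at hU
    obtain ⟨f, hf⟩ := hU
    exact mem_iUnion.2 ⟨f 0, f, rfl, hf⟩
  intro e
  have key : ∀ n : ℕ, clockMeasure d {U | ∃ f : ℕ → Edge d, f 0 = e ∧ Function.Injective f ∧
      (∀ i, Touches (f (i + 1)) (f i)) ∧ ∀ i, U (f i) ∈ I} ≤ (C * volume I) ^ n := by
    intro n
    calc _ ≤ clockMeasure d (⋃ l : {l : List.Vector (Fin C) n // (follow nb e l.1).Nodup ∧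
            (follow nb e l.1).length = n + 1},
          {U | ∀ g ∈ (follow nb e l.1.1).toFinset, U g ∈ I}) := by
          refine measure_mono ?_
          rintro U ⟨f, rfl, hinj, hf, hU⟩
          obtain ⟨l, hl, h⟩ := exists_follow hnb n f hf
          refine mem_iUnion.2 ⟨⟨⟨l, hl⟩, ?_, ?_⟩, ?_⟩
          · simp only [h]; exact List.nodup_range.map hinj
          · simp [h]
          · intro g hg
            simp only [h, List.mem_toFinset, List.mem_map] at hg
            obtain ⟨i, -, rfl⟩ := hg
            exact hU i
      _ ≤ ∑ l : {l : List.Vector (Fin C) n // (follow nb e l.1).Nodup ∧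
            (follow nb e l.1).length = n + 1},
          clockMeasure d {U | ∀ g ∈ (follow nb e l.1.1).toFinset, U g ∈ I} :=
          measure_iUnion_fintype_le _ _
      _ ≤ ∑ l : {l : List.Vector (Fin C) n // (follow nb e l.1).Nodup ∧
            (follow nb e l.1).length = n + 1}, volume I ^ n := by
          refine Finset.sum_le_sum fun l _ => ?_
          rw [clockMeasure_forall_mem _ hI, List.toFinset_card_of_nodup l.2.1, l.2.2]
          exact pow_le_pow_right_of_le_one' prob_le_one (Nat.le_succ n)
      _ ≤ _ := by
          rw [Finset.sum_const, nsmul_eq_mul, mul_pow, Finset.card_univ]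
          gcongr
          refine (Nat.cast_le.2 (Fintype.card_subtype_le _)).trans ?_
          simp
  refine le_antisymm (ge_of_tendsto' (ENNReal.tendsto_pow_atTop_nhds_zero_of_lt_one hC) key)
    zero_le

theorem volume_window_le (a b : ℝ) :
    volume {x : unitInterval | a ≤ x ∧ (x : ℝ) ≤ b} ≤ ENNReal.ofReal (b - a) := by
  rw [unitInterval.volume_apply, ← Real.volume_Icc]
  refine measure_mono ?_
  rintro _ ⟨x, hx, rfl⟩
  exact hx

/-- Almost surely, there is no infinite chain of adjacent edges with decreasing clocks. -/
theorem ae_wellFounded (d : ℕ) : ∀ᵐ U ∂clockMeasure d, WellFounded (Precedes U) := by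
  obtain ⟨C, nb, hC, hnb⟩ := exists_enumeration d
  -- The clocks along a descending chain decrease to a limit `ℓ`, so they end up in `[ℓ, ℓ + 1/m]`.
  -- This lies in the window `[j/m, (j+2)/m]` with `j = ⌊ℓ m⌋`, and the choice of `m` gives `C *
  -- (2/m) < 1`.
  set m : ℝ := 2 * C + 1 with hm
  have hm0 : 0 < m := by positivity
  have hI : ∀ j : ℕ, MeasurableSet {x : unitInterval | (j : ℝ) / m ≤ x ∧ (x : ℝ) ≤ (j + 2) / m} :=
    fun j => by measurability
  have hvol : ∀ j : ℕ, C * volume {x : unitInterval | (j : ℝ) / m ≤ x ∧ (x : ℝ) ≤ (j + 2) / m}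
      < 1 := fun j => by
    calc _ ≤ (C : ENNReal) * ENNReal.ofReal ((j + 2) / m - j / m) := by
          gcongr; exact volume_window_le _ _
      _ = ENNReal.ofReal (C * (2 / m)) := by
          rw [ENNReal.ofReal_mul (by positivity), ENNReal.ofReal_natCast]; congr; ring
      _ < 1 := by
          rw [← ENNReal.ofReal_one]
          refine (ENNReal.ofReal_lt_ofReal_iff one_pos).2 ?_
          rw [← mul_div_assoc, div_lt_one hm0]; linarith
  have := ae_all_iff.2 fun j : ℕ => ae_no_path_in hnb (hI j) (hvol j)
  filter_upwards [this] with U hU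
  rw [wellFounded_iff_isEmpty_descending_chain]
  refine ⟨fun ⟨f, hf⟩ => ?_⟩
  have hanti : StrictAnti (fun n => U (f n)) := strictAnti_nat_of_succ_lt fun n => (hf n).2
  have hanti' : Antitone (fun n => (U (f n) : ℝ)) := fun a b h => hanti.antitone h
  have hlim := tendsto_atTop_ciInf hanti' ⟨0, by rintro _ ⟨n, rfl⟩; exact (U (f n)).2.1⟩
  set ℓ : ℝ := ⨅ n, (U (f n) : ℝ)
  have hge : ∀ n, ℓ ≤ U (f n) := fun n =>
    ciInf_le ⟨0, by rintro _ ⟨n, rfl⟩; exact (U (f n)).2.1⟩ n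
  have hℓ0 : 0 ≤ ℓ := le_ciInf fun n => (U (f n)).2.1
  have hev := hlim.eventually (gt_mem_nhds (show ℓ < ℓ + 1 / m by simp [hm0]))
  obtain ⟨N, hN⟩ := hev.exists_forall_of_atTop
  refine hU ⌊ℓ * m⌋₊ ⟨fun n => f (n + N), ?_, fun i => ?_, fun i => ⟨?_, ?_⟩⟩
  · intro a b h
    have := hanti.injective (congrArg U h)
    omega
  · have := (hf (i + N)).1
    rwa [show i + N + 1 = i + 1 + N by ring] at this
  · refine le_trans ?_ (hge _)
    rw [div_le_iff₀ hm0]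
    exact Nat.floor_le (by positivity)
  · refine (hN (i + N) (by omega)).le.trans ?_
    rw [le_div_iff₀ hm0, add_mul, div_mul_cancel₀ _ hm0.ne']
    have := Nat.lt_floor_add_one (ℓ * m)
    linarith

/-- Almost surely, all the clocks are distinct. -/
theorem ae_injective (d : ℕ) : ∀ᵐ U ∂clockMeasure d, Function.Injective U := by
  have h : ∀ p : Edge d × Edge d, ∀ᵐ U ∂clockMeasure d, p.1 ≠ p.2 → U p.1 ≠ U p.2 := by
    rintro ⟨e, f⟩
    by_cases hef : e = f
    · simp [hef]
    have := Measure.infinitePi_map_eval_prod (P := fun _ : Edge d => (volume : Measure unitInterval))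
      hef
    have h0 : ((volume : Measure unitInterval).prod volume) {p | p.1 = p.2} = 0 := by
      rw [Measure.prod_apply (measurableSet_eq_fun measurable_fst measurable_snd)]
      simp [preimage]
    rw [← this, Measure.map_apply (by fun_prop)
      (measurableSet_eq_fun measurable_fst measurable_snd)] at h0
    rw [ae_iff]
    refine measure_mono_null ?_ h0
    intro U hU
    simp only [Classical.not_imp, not_not] at hU
    exact hU.2
  filter_upwards [ae_all_iff.2 h] with U hU
  intro e f hef
  by_contra hne
  exact hU (e, f) hne hef

/-- Almost surely, no clock rings at the times `0` and `1`. -/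
theorem ae_mem_Ioo (d : ℕ) : ∀ᵐ U ∂clockMeasure d, ∀ e, 0 < U e ∧ U e < 1 := by
  refine ae_all_iff.2 fun e => ?_
  have h : ∀ c : unitInterval, ∀ᵐ U ∂clockMeasure d, U e ≠ c := fun c => by
    have := clockMeasure_forall_mem {e} (measurableSet_singleton c)
    simp only [Finset.mem_singleton, forall_eq, mem_singleton_iff, measure_singleton,
      Finset.card_singleton, pow_one] at this
    rw [ae_iff]
    simpa using this
  filter_upwards [h 0, h 1] with U h0 h1
  exact ⟨unitInterval.pos_iff_ne_zero.2 h0, unitInterval.lt_one_iff_ne_one.2 h1⟩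

/-! ### The dynamics for regular clocks, and the degree bound. -/

/-- Only finitely many edges meet a site, so its degree just before `U e` is already attained at the
last earlier ring. A set of at least `k ≥ 1` such edges is nonempty, so that last ring exists. -/
theorem isEvolution_iff {k : ℕ} (hk : 1 ≤ k) {U : Clocks d} {O : Set (Edge d)} :
    IsEvolution k U O ↔
      ∀ e, e ∈ O ↔ ∀ v ∈ e.1, {f : Edge d | v ∈ f.1 ∧ f ∈ O ∧ U f < U e}.encard < k := by
  refine forall_congr' fun e => ?_
  suffices h : (∀ s < U e, ∀ v ∈ e.1, degreeAt U O s v < k) ↔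
      ∀ v ∈ e.1, {f : Edge d | v ∈ f.1 ∧ f ∈ O ∧ U f < U e}.encard < k by rw [h]
  constructor
  · intro h v hv
    by_contra! hcon
    have hfin : {f : Edge d | v ∈ f.1 ∧ f ∈ O ∧ U f < U e}.Finite :=
      (edges_at_finite v).subset fun f hf => hf.1
    have hne : {f : Edge d | v ∈ f.1 ∧ f ∈ O ∧ U f < U e}.Nonempty := by
      rw [← encard_pos]
      exact lt_of_lt_of_le (by exact_mod_cast hk) hcon
    obtain ⟨g, hg, hmax⟩ := exists_max_image _ U hfin hne
    refine absurd (h (U g) hg.2.2 v hv) (not_lt.2 (hcon.trans (encard_le_encard ?_)))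
    exact fun f hf => ⟨hf.1, hf.2.1, hmax f hf⟩
  · intro h s hs v hv
    refine lt_of_le_of_lt (encard_le_encard ?_) (h v hv)
    exact fun f hf => ⟨hf.1, hf.2.1, hf.2.2.trans_lt hs⟩

/-- The almost sure properties of the clocks. -/
structure Regular (U : Clocks d) : Prop where
  wf : WellFounded (Precedes U)
  inj : Function.Injective U
  pos : ∀ e, 0 < U e
  lt_one : ∀ e, U e < 1

theorem ae_regular (d : ℕ) : ∀ᵐ U ∂clockMeasure d, Regular U := by
  filter_upwards [ae_wellFounded d, ae_injective d, ae_mem_Ioo d] with U h1 h2 h3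
  exact ⟨h1, h2, fun e => (h3 e).1, fun e => (h3 e).2⟩

/-- The last edge to open at `v` found fewer than `k` open edges there; since clocks are distinct,
all the others opened strictly earlier. -/
theorem IsEvolution.degree_le {k : ℕ} (hk : 1 ≤ k) {U : Clocks d} (hU : Function.Injective U)
    {O : Set (Edge d)} (hO : IsEvolution k U O) (v : Fin d → ℤ) :
    {f : Edge d | v ∈ f.1 ∧ f ∈ O}.encard ≤ k := by
  rw [isEvolution_iff hk] at hO
  have hfin : {f : Edge d | v ∈ f.1 ∧ f ∈ O}.Finite :=
    (edges_at_finite v).subset fun f hf => hf.1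
  rcases eq_empty_or_nonempty {f : Edge d | v ∈ f.1 ∧ f ∈ O} with h | hne
  · simp [h]
  obtain ⟨e, he, hmax⟩ := exists_max_image _ U hfin hne
  have hlt := (hO e).1 he.2 v he.1
  have hsub : {f : Edge d | v ∈ f.1 ∧ f ∈ O} ⊆
      insert e {f : Edge d | v ∈ f.1 ∧ f ∈ O ∧ U f < U e} := fun f hf => by
    by_cases hfe : f = e
    · exact Or.inl hfe
    · exact Or.inr ⟨hf.1, hf.2, (hmax f hf).lt_of_ne fun h => hfe (hU h)⟩
  exact (encard_le_encard hsub).trans ((encard_insert_le _ _).trans (Order.add_one_le_of_lt hlt))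

theorem mem_openEdges_iff {k : ℕ} {U : Clocks d} (hU : WellFounded (Precedes U))
    {O : Set (Edge d)} (hO : IsEvolution k U O) {t : unitInterval} {e : Edge d} :
    e ∈ openEdges k U t ↔ e ∈ O ∧ U e ≤ t := by
  constructor
  · rintro ⟨O', hO', h⟩
    rwa [(existsUnique_isEvolution k U hU).unique hO hO']
  · exact fun h => ⟨O, hO, h⟩

theorem openGraph_adj_iff {k : ℕ} {U : Clocks d} {t : unitInterval} {v w : Fin d → ℤ} :
    (openGraph k U t).Adj v w ↔ ∃ h : (lattice d).Adj v w, mkEdge h ∈ openEdges k U t := by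
  rw [openGraph, SimpleGraph.fromEdgeSet_adj]
  constructor
  · rintro ⟨⟨e, he, h⟩, -⟩
    have hadj : (lattice d).Adj v w := by have := e.2; rwa [h] at this
    refine ⟨hadj, ?_⟩
    rwa [show mkEdge hadj = e from Subtype.ext h.symm]
  · rintro ⟨h, he⟩
    exact ⟨⟨_, he, rfl⟩, h.ne⟩

theorem openGraph_le {k : ℕ} {U : Clocks d} {t : unitInterval} : openGraph k U t ≤ lattice d :=
  fun _ _ h => (openGraph_adj_iff.1 h).1

theorem openGraph_degree_le {k : ℕ} (hk : 1 ≤ k) {U : Clocks d} (hU : Regular U)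
    (t : unitInterval) (v : Fin d → ℤ) : ((openGraph k U t).neighborSet v).encard ≤ k := by
  obtain ⟨O, hO, -⟩ := existsUnique_isEvolution k U hU.wf
  refine le_trans ?_ (hO.degree_le hk hU.inj v)
  have hinj : InjOn (fun w => s(v, w)) ((openGraph k U t).neighborSet v) :=
    fun a _ b _ h => Sym2.congr_right.1 h
  rw [← hinj.encard_image, ← Subtype.val_injective.injOn.encard_image]
  refine encard_le_encard ?_
  rintro _ ⟨w, hw, rfl⟩
  obtain ⟨h, he⟩ := openGraph_adj_iff.1 hw
  exact ⟨mkEdge h, ⟨Sym2.mem_mk_left v w, ((mem_openEdges_iff hU.wf hO).1 he).1⟩, rfl⟩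

/-! ### Measurability of the open graph and of its clusters. -/

/-- Finite iterations of the rule that defines the dynamics. -/
def approxEvolution (k : ℕ) (U : Clocks d) : ℕ → Set (Edge d)
  | 0 => ∅
  | n + 1 => {e | ∀ v ∈ e.1, {f : Edge d | v ∈ f.1 ∧ f ∈ approxEvolution k U n ∧ U f < U e}.encard < k}

/-- The state of an edge depends only on its finitely many earlier neighbours, so it is settled one
iteration after theirs. -/
theorem eventually_mem_approxEvolution_iff {k : ℕ} (hk : 1 ≤ k) {U : Clocks d}
    (hU : WellFounded (Precedes U)) {O : Set (Edge d)} (hO : IsEvolution k U O) (e : Edge d) :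
    ∃ n, ∀ m ≥ n, e ∈ approxEvolution k U m ↔ e ∈ O := by
  induction e using hU.induction with
  | _ e ih =>
    choose! N hN using ih
    have hfin : (N '' {f | Touches f e}).Finite := (touches_finite e).image N
    obtain ⟨B, hB⟩ := hfin.bddAbove
    refine ⟨B + 1, fun m hm => ?_⟩
    obtain ⟨m, rfl⟩ : ∃ m', m = m' + 1 := ⟨m - 1, by omega⟩
    rw [(isEvolution_iff hk).1 hO e, approxEvolution, mem_ofPred_eq]
    refine forall₂_congr fun v hv => ?_
    have : {f : Edge d | v ∈ f.1 ∧ f ∈ approxEvolution k U m ∧ U f < U e} =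
        {f : Edge d | v ∈ f.1 ∧ f ∈ O ∧ U f < U e} := by
      ext f
      refine and_congr_right fun hvf => and_congr_left fun hlt => ?_
      refine hN f ⟨⟨v, hvf, hv⟩, hlt⟩ m ?_
      have := hB ⟨f, ⟨v, hvf, hv⟩, rfl⟩
      omega
    rw [this]

/-- Turns a degree bound into a countable intersection over finite edge sets, which makes it a
measurable condition. -/
theorem encard_lt_iff_forall_finset {α : Type*} {s : Set α} {k : ℕ} :
    s.encard < k ↔ ∀ F : Finset α, F.card = k → ¬ (F : Set α) ⊆ s := by
  rw [← not_le, ← not_iff_not, not_not]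
  push Not
  constructor
  · intro h
    obtain ⟨t, hts, htk⟩ := exists_subset_encard_eq h
    have hfin : t.Finite := finite_of_encard_eq_coe htk
    refine ⟨hfin.toFinset, ?_, by simpa using hts⟩
    have := hfin.encard_eq_coe_toFinset_card
    rw [htk] at this
    exact_mod_cast this.symm
  · rintro ⟨F, hF, hs⟩
    rw [← hF, ← encard_coe_eq_coe_finsetCard]
    exact encard_le_encard hs

theorem measurableSet_approxEvolution (k n : ℕ) (e : Edge d) :
    MeasurableSet {U : Clocks d | e ∈ approxEvolution k U n} := by
  induction n generalizing e with
  | zero => simp [approxEvolution]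
  | succ n ih =>
    have : {U : Clocks d | e ∈ approxEvolution k U (n + 1)} =
        ⋂ v : {v // v ∈ e.1}, ⋂ F : {F : Finset (Edge d) // F.card = k},
          (⋂ f ∈ F.1, {U : Clocks d | v.1 ∈ f.1} ∩
            ({U : Clocks d | f ∈ approxEvolution k U n} ∩ {U | U f < U e}))ᶜ := by
      ext U
      simp only [approxEvolution, mem_ofPred_eq, encard_lt_iff_forall_finset, mem_iInter,
        Subtype.forall, mem_compl_iff, mem_inter_iff, subset_def, Finset.mem_coe]
    rw [this]
    refine MeasurableSet.iInter fun v => MeasurableSet.iInter fun F => MeasurableSet.compl ?_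
    refine Finset.measurableSet_biInter _ fun f _ => ?_
    refine (MeasurableSet.const _).inter ((ih f).inter ?_)
    exact measurableSet_lt (measurable_pi_apply f) (measurable_pi_apply e)

/-- Off the null set of clocks with infinite descending chains, the event is a lower limit of
measurable events. On that null set nothing is known, so only null measurability results. -/
theorem nullMeasurableSet_openEdges {k : ℕ} (hk : 1 ≤ k) (t : unitInterval) (e : Edge d) :
    NullMeasurableSet {U : Clocks d | e ∈ openEdges k U t} (clockMeasure d) := by
  have h : MeasurableSet ((⋃ n, ⋂ m ≥ n, {U : Clocks d | e ∈ approxEvolution k U m}) ∩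
      {U | U e ≤ t}) :=
    (MeasurableSet.iUnion fun n => MeasurableSet.iInter fun m => MeasurableSet.iInter fun _ =>
      measurableSet_approxEvolution k m e).inter
      (measurableSet_le (measurable_pi_apply e) measurable_const)
  refine h.nullMeasurableSet.congr (Filter.eventuallyEq_set.2 ?_)
  filter_upwards [ae_wellFounded d] with U hU
  obtain ⟨O, hO, -⟩ := existsUnique_isEvolution k U hU
  obtain ⟨n, hn⟩ := eventually_mem_approxEvolution_iff hk hU hO e
  simp only [mem_inter_iff, mem_iUnion, mem_iInter, mem_ofPred_eq, mem_openEdges_iff hU hO]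
  refine and_congr_left fun _ => ⟨?_, fun h => ⟨n, fun m hm => (hn m hm).2 h⟩⟩
  rintro ⟨n', h⟩
  exact (hn _ (le_max_left n n')).1 (h _ (le_max_right n n'))

theorem nullMeasurableSet_adj {k : ℕ} (hk : 1 ≤ k) (t : unitInterval) (v w : Fin d → ℤ) :
    NullMeasurableSet {U : Clocks d | (openGraph k U t).Adj v w} (clockMeasure d) := by
  by_cases h : (lattice d).Adj v w
  · convert nullMeasurableSet_openEdges hk t (mkEdge h) using 3 with U
    exact openGraph_adj_iff.trans ⟨fun h => h.2, fun h' => ⟨h, h'⟩⟩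
  · convert nullMeasurableSet_empty
    ext U
    simp [openGraph_adj_iff, h]

section Measurability

variable {Ω V : Type*} [MeasurableSpace Ω] {μ : Measure Ω} [Countable V] {G : Ω → SimpleGraph V}

theorem nullMeasurableSet_reachable (hG : ∀ v w, NullMeasurableSet {ω | (G ω).Adj v w} μ)
    (v w : V) : NullMeasurableSet {ω | (G ω).Reachable v w} μ := by
  have key : ∀ n v, NullMeasurableSet {ω | ∃ p : (G ω).Walk v w, p.length = n} μ := by
    intro n
    induction n with
    | zero =>
      intro v
      by_cases h : v = w
      · subst h
        convert nullMeasurableSet_univ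
        ext ω
        exact iff_of_true ⟨.nil, rfl⟩ trivial
      · convert nullMeasurableSet_empty
        ext ω
        exact iff_of_false (fun ⟨p, hp⟩ => h (SimpleGraph.Walk.eq_of_length_eq_zero hp)) id
    | succ n ih =>
      intro v
      have : {ω | ∃ p : (G ω).Walk v w, p.length = n + 1} =
          ⋃ u, {ω | (G ω).Adj v u} ∩ {ω | ∃ p : (G ω).Walk u w, p.length = n} := by
        ext ω
        simp only [mem_iUnion, mem_inter_iff, mem_ofPred_eq]
        constructor
        · rintro ⟨p, hp⟩
          cases p with
          | nil => simp at hp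
          | cons h q => exact ⟨_, h, q, by simpa using hp⟩
        · rintro ⟨u, h, q, hq⟩
          exact ⟨.cons h q, by simp [hq]⟩
      rw [this]
      exact NullMeasurableSet.iUnion fun u => (hG v u).inter (ih u)
  have : {ω | (G ω).Reachable v w} = ⋃ n, {ω | ∃ p : (G ω).Walk v w, p.length = n} := by
    ext ω
    simp only [mem_iUnion, mem_ofPred_eq]
    exact ⟨fun ⟨p⟩ => ⟨_, p, rfl⟩, fun ⟨_, p, _⟩ => ⟨p⟩⟩
  rw [this]
  exact NullMeasurableSet.iUnion fun n => key n v

theorem nullMeasurableSet_infinite (hG : ∀ v w, NullMeasurableSet {ω | (G ω).Adj v w} μ)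
    (v : V) : NullMeasurableSet {ω | {w | (G ω).Reachable v w}.Infinite} μ := by
  have : {ω | {w | (G ω).Reachable v w}.Infinite} =
      ⋂ F : Finset V, ⋃ w : {w // w ∉ F}, {ω | (G ω).Reachable v w} := by
    ext ω
    simp only [mem_iInter, mem_iUnion, mem_ofPred_eq]
    constructor
    · intro h F
      obtain ⟨w, hw, hF⟩ := h.exists_notMem_finset F
      exact ⟨⟨w, hF⟩, hw⟩
    · intro h hfin
      obtain ⟨⟨w, hw⟩, hr⟩ := h hfin.toFinset
      exact hw (by simpa using hr)
  rw [this]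
  exact NullMeasurableSet.iInter fun F => NullMeasurableSet.iUnion fun w =>
    nullMeasurableSet_reachable hG v w

end Measurability

/-! ### Translations, mixing and the zero-one law. -/

theorem lattice_adj_add (x : Fin d → ℤ) {v w : Fin d → ℤ} :
    (lattice d).Adj (v + x) (w + x) ↔ (lattice d).Adj v w := by
  simp [lattice]

/-- Translation of edges. -/
def shiftEdge (x : Fin d → ℤ) (e : Edge d) : Edge d :=
  ⟨e.1.map (· + x), by
    obtain ⟨⟨a, b⟩, h⟩ := e
    exact (lattice_adj_add x).2 h⟩

theorem shiftEdge_neg (x : Fin d → ℤ) (e : Edge d) : shiftEdge (-x) (shiftEdge x e) = e := by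
  obtain ⟨⟨a, b⟩, h⟩ := e
  refine Subtype.ext ?_
  change s(a + x + -x, b + x + -x) = s(a, b)
  simp

theorem shiftEdge_neg' (x : Fin d → ℤ) (e : Edge d) : shiftEdge x (shiftEdge (-x) e) = e := by
  have := shiftEdge_neg (-x) e
  rwa [neg_neg] at this

theorem shiftEdge_injective (x : Fin d → ℤ) : Function.Injective (shiftEdge x) :=
  Function.LeftInverse.injective (shiftEdge_neg x)

theorem mem_shiftEdge {x v : Fin d → ℤ} {e : Edge d} : v + x ∈ (shiftEdge x e).1 ↔ v ∈ e.1 := by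
  simp [shiftEdge, Sym2.mem_map]

/-- Translation of clocks. -/
def shift (x : Fin d → ℤ) (U : Clocks d) : Clocks d := fun e => U (shiftEdge x e)

theorem shift_neg (x : Fin d → ℤ) (U : Clocks d) : shift (-x) (shift x U) = U := by
  funext e
  simp [shift, shiftEdge_neg']

theorem measurePreserving_shift (x : Fin d → ℤ) :
    MeasurePreserving (shift x) (clockMeasure d) (clockMeasure d) :=
  ⟨by unfold shift; fun_prop, Measure.map_infinitePi_infinitePi_of_inj
    (P := fun _ : Edge d => (volume : Measure unitInterval)) (shiftEdge_injective x)⟩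

theorem IsEvolution.shift {k : ℕ} {U : Clocks d} {O : Set (Edge d)} (h : IsEvolution k U O)
    (x : Fin d → ℤ) : IsEvolution k (CDP.shift x U) (shiftEdge x ⁻¹' O) := by
  intro e
  rw [mem_preimage, h]
  have hdeg : ∀ s v, degreeAt (CDP.shift x U) (shiftEdge x ⁻¹' O) s v =
      degreeAt U O s (v + x) := fun s v => by
    unfold degreeAt
    rw [← (shiftEdge_injective x).injOn.encard_image]
    congr 1
    ext f
    constructor
    · rintro ⟨g, ⟨h1, h2, h3⟩, rfl⟩
      exact ⟨mem_shiftEdge.2 h1, h2, h3⟩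
    · rintro ⟨h1, h2, h3⟩
      refine ⟨shiftEdge (-x) f, ⟨?_, ?_, ?_⟩, shiftEdge_neg' x f⟩
      · rwa [← mem_shiftEdge (x := x), shiftEdge_neg']
      · rwa [mem_preimage, shiftEdge_neg']
      · rwa [CDP.shift, shiftEdge_neg']
  refine forall₂_congr fun s _ => ⟨fun h v hv => ?_, fun h v hv => ?_⟩
  · rw [hdeg]
    exact h _ (mem_shiftEdge.2 hv)
  · have h1 : v - x ∈ e.1 := by
      rw [← mem_shiftEdge (x := x)]
      simpa using hv
    have := h _ h1
    rwa [hdeg, sub_add_cancel] at this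

theorem mem_openEdges_shift {k : ℕ} {U : Clocks d} {t : unitInterval} {x : Fin d → ℤ}
    {e : Edge d} : e ∈ openEdges k (shift x U) t ↔ shiftEdge x e ∈ openEdges k U t := by
  constructor
  · rintro ⟨O, hO, he, ht⟩
    have := hO.shift (-x)
    rw [shift_neg] at this
    exact ⟨_, this, by rwa [mem_preimage, shiftEdge_neg], ht⟩
  · rintro ⟨O, hO, he, ht⟩
    exact ⟨_, hO.shift x, he, ht⟩

theorem openGraph_shift_adj {k : ℕ} {U : Clocks d} {t : unitInterval} {x v w : Fin d → ℤ} :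
    (openGraph k (shift x U) t).Adj v w ↔ (openGraph k U t).Adj (v + x) (w + x) := by
  simp only [openGraph_adj_iff, mem_openEdges_shift]
  constructor
  · rintro ⟨h, h'⟩
    exact ⟨(lattice_adj_add x).2 h, h'⟩
  · rintro ⟨h, h'⟩
    exact ⟨(lattice_adj_add x).1 h, h'⟩

/-- The translation of open graphs as an isomorphism. -/
def shiftIso (k : ℕ) (U : Clocks d) (t : unitInterval) (x : Fin d → ℤ) :
    openGraph k (shift x U) t ≃g openGraph k U t where
  toEquiv := Equiv.addRight x
  map_rel_iff' := openGraph_shift_adj.symm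

theorem openGraph_shift_reachable {k : ℕ} {U : Clocks d} {t : unitInterval}
    {x v w : Fin d → ℤ} : (openGraph k (shift x U) t).Reachable v w ↔
      (openGraph k U t).Reachable (v + x) (w + x) :=
  (shiftIso k U t x).reachable_iff.symm

theorem cluster_shift_infinite {k : ℕ} {U : Clocks d} {t : unitInterval} {x v : Fin d → ℤ} :
    (cluster k (shift x U) t v).Infinite ↔ (cluster k U t (v + x)).Infinite := by
  have : cluster k U t (v + x) = (· + x) '' cluster k (shift x U) t v := by
    ext w
    simp only [cluster, mem_image, mem_ofPred_eq, openGraph_shift_reachable]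
    exact ⟨fun h => ⟨w - x, by simpa using h, by simp⟩, by rintro ⟨w, h, rfl⟩; exact h⟩
  rw [this, infinite_image_iff (add_left_injective x).injOn]

theorem finite_setOf_shiftEdge_eq (e f : Edge d) : {x | shiftEdge x f = e}.Finite := by
  obtain ⟨⟨a, b⟩, h⟩ := f
  refine Set.Finite.subset (Set.Finite.image (fun v => v - a) (s := {v | v ∈ e.1}) ?_) ?_
  · obtain ⟨⟨a, b⟩, h⟩ := e
    refine (Set.toFinite {a, b}).subset fun v hv => ?_
    simpa using hv
  · rintro x rfl
    exact ⟨a + x, mem_shiftEdge.2 (Sym2.mem_mk_left a b), by simp⟩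

theorem real_inter_shift_of_cylinder {I J : Finset (Edge d)} {S : Set (I → unitInterval)}
    {T : Set (J → unitInterval)} (hS : MeasurableSet S) (hT : MeasurableSet T) {x : Fin d → ℤ}
    (hx : ∀ e ∈ I, ∀ f ∈ J, shiftEdge x f ≠ e) :
    (clockMeasure d).real (cylinder I S ∩ shift x ⁻¹' cylinder J T) =
      (clockMeasure d).real (cylinder I S) * (clockMeasure d).real (cylinder J T) := by
  classical
  have hind := (ProbabilityTheory.iIndepFun_infinitePi
    (P := fun _ : Edge d => (volume : Measure unitInterval))
    (X := fun _ u => u) fun _ => measurable_id).indepFun_finset I (J.image (shiftEdge x))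
    (Finset.disjoint_left.2 fun e he hf => by
      obtain ⟨g, hg, rfl⟩ := Finset.mem_image.1 hf
      exact hx _ he g hg rfl) fun i => measurable_pi_apply i
  let r : (J.image (shiftEdge x) → unitInterval) → (J → unitInterval) :=
    fun w j => w ⟨shiftEdge x j, Finset.mem_image_of_mem _ j.2⟩
  have hr : Measurable r := by fun_prop
  have := hind.measure_inter_preimage_eq_mul S (r ⁻¹' T) hS (hr hT)
  have h2 : (clockMeasure d).real (cylinder J T) =
      (clockMeasure d).real (shift x ⁻¹' cylinder J T) := by
    rw [(measurePreserving_shift x).measureReal_preimage (hT.cylinder J).nullMeasurableSet]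
  rw [h2, measureReal_def, measureReal_def, measureReal_def, ← ENNReal.toReal_mul]
  exact congrArg ENNReal.toReal this

/-- Approximate both events by cylinders up to `ε/4`. Except for finitely many translations, the two
cylinders read disjoint sets of clocks and are exactly independent. The approximation costs `ε/4`
twice in the intersection and twice in the product. -/
theorem mixing {A B : Set (Clocks d)} (hA : NullMeasurableSet A (clockMeasure d))
    (hB : NullMeasurableSet B (clockMeasure d)) {ε : ℝ} (hε : 0 < ε) :
    {x | ε ≤ |(clockMeasure d).real (A ∩ shift x ⁻¹' B) -
      (clockMeasure d).real A * (clockMeasure d).real B|}.Finite := by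
  set μ := clockMeasure d with hμ
  have hdense : μ.MeasureDense (measurableCylinders fun _ : Edge d => unitInterval) :=
    Measure.MeasureDense.of_generateFrom_isSetAlgebra_finite _ isSetAlgebra_measurableCylinders
      generateFrom_measurableCylinders.symm
  have happrox : ∀ s, NullMeasurableSet s μ → ∃ (I : Finset (Edge d)) (S : Set (I → unitInterval)),
      MeasurableSet S ∧ μ.real (symmDiff s (cylinder I S)) < ε / 4 := fun s hs => by
    obtain ⟨t, ht, hst⟩ := hdense.approx (toMeasurable μ s) (measurableSet_toMeasurable μ s)
      (measure_ne_top _ _) (ε / 4) (by positivity)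
    obtain ⟨I, S, hS, rfl⟩ := (mem_measurableCylinders t).1 ht
    refine ⟨I, S, hS, ?_⟩
    have hae : (symmDiff s (cylinder I S) : Set (Clocks d)) =ᵐ[μ]
        (symmDiff (toMeasurable μ s) (cylinder I S) : Set (Clocks d)) :=
      ae_eq_set_symmDiff hs.toMeasurable_ae_eq.symm Filter.EventuallyEq.rfl
    rw [measureReal_def, measure_congr hae]
    exact ENNReal.toReal_lt_of_lt_ofReal hst
  obtain ⟨I, S, hS, hAS⟩ := happrox A hA
  obtain ⟨J, T, hT, hBT⟩ := happrox B hB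
  have hfin : (⋃ e ∈ I, ⋃ f ∈ J, {x | shiftEdge x f = e}).Finite :=
    Set.Finite.biUnion I.finite_toSet fun e _ => Set.Finite.biUnion J.finite_toSet fun f _ =>
      finite_setOf_shiftEdge_eq e f
  refine hfin.subset fun x hx => ?_
  by_contra hcon
  have hx' : ∀ e ∈ I, ∀ f ∈ J, shiftEdge x f ≠ e := fun e he f hf h => hcon <| by
    simp only [mem_iUnion]
    exact ⟨e, he, f, hf, h⟩
  have hSm := (hS.cylinder I).nullMeasurableSet (μ := μ)
  have hTm := (hT.cylinder J).nullMeasurableSet (μ := μ)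
  have heq := real_inter_shift_of_cylinder hS hT hx'
  rw [← hμ] at heq
  have hsh := (measurePreserving_shift x).quasiMeasurePreserving
  have h1 : |μ.real A - μ.real (cylinder I S)| ≤ ε / 4 :=
    (abs_measureReal_sub_le_measureReal_symmDiff' hA hSm (by finiteness) (by finiteness)).trans hAS.le
  have h2 : |μ.real B - μ.real (cylinder J T)| ≤ ε / 4 :=
    (abs_measureReal_sub_le_measureReal_symmDiff' hB hTm (by finiteness) (by finiteness)).trans hBT.le
  have h3 : |μ.real (A ∩ shift x ⁻¹' B) - μ.real (cylinder I S ∩ shift x ⁻¹' cylinder J T)| <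
      ε / 4 + ε / 4 := by
    refine lt_of_le_of_lt (abs_measureReal_sub_le_measureReal_symmDiff'
      (hA.inter (hB.preimage hsh)) (hSm.inter (hTm.preimage hsh)) (by finiteness)
      (by finiteness)) ?_
    have hsub : symmDiff (A ∩ shift x ⁻¹' B) (cylinder I S ∩ shift x ⁻¹' cylinder J T) ⊆
        symmDiff A (cylinder I S) ∪ shift x ⁻¹' symmDiff B (cylinder J T) := by
      intro U hU
      simp only [mem_symmDiff, mem_inter_iff, mem_union, mem_preimage] at hU ⊢
      tauto
    have hpre : μ.real (shift x ⁻¹' symmDiff B (cylinder J T)) =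
        μ.real (symmDiff B (cylinder J T)) :=
      (measurePreserving_shift x).measureReal_preimage (hB.symmDiff hTm)
    calc _ ≤ _ := measureReal_mono hsub
      _ ≤ _ := measureReal_union_le _ _
      _ < _ := by rw [hpre]; exact add_lt_add hAS hBT
  have hx2 : ε ≤ |μ.real (A ∩ shift x ⁻¹' B) - μ.real A * μ.real B| := hx
  have hb1 : μ.real B ≤ 1 := measureReal_le_one
  have hb0 : 0 ≤ μ.real B := measureReal_nonneg
  have ha1 : μ.real (cylinder I S) ≤ 1 := measureReal_le_one
  have ha0 : 0 ≤ μ.real (cylinder I S) := measureReal_nonneg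
  rw [heq] at h3
  rw [abs_le] at h1 h2
  rw [abs_lt] at h3
  refine absurd hx2 (not_le.2 (abs_lt.2 ?_))
  constructor <;> nlinarith

/-- Mixing makes an invariant event independent of itself. The condition `1 ≤ d` provides infinitely
many translations, hence one outside the finite exceptional set. -/
theorem measureReal_eq_zero_or_one_of_shift_invariant (hd : 1 ≤ d) {A : Set (Clocks d)}
    (hA : NullMeasurableSet A (clockMeasure d)) (hinv : ∀ x, shift x ⁻¹' A = A) :
    (clockMeasure d).real A = 0 ∨ (clockMeasure d).real A = 1 := by
  have : Nonempty (Fin d) := ⟨⟨0, hd⟩⟩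
  have h : ∀ ε > 0, |(clockMeasure d).real A - (clockMeasure d).real A * (clockMeasure d).real A|
      < ε := fun ε hε => by
    obtain ⟨x, hx⟩ := (mixing hA hA hε).exists_notMem
    rw [mem_ofPred_eq, hinv x, inter_self] at hx
    exact not_le.1 hx
  have h0 : (clockMeasure d).real A - (clockMeasure d).real A * (clockMeasure d).real A = 0 := by
    by_contra hne
    exact lt_irrefl _ (h _ (abs_pos.2 hne))
  have : (clockMeasure d).real A * (1 - (clockMeasure d).real A) = 0 := by linarith
  rcases mul_eq_zero.1 this with h | h
  · exact Or.inl h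
  · exact Or.inr (by linarith)

/-! ### Local modification of the clocks. -/

/-- Changing the clocks of the edges in `F` so that the edges of `R ⊆ F` open early and the other
edges of `F` ring late does not affect the other edges up to time `t`, provided that near the
boundary of `F` the set `R` agrees with the set of edges open at time `t`. -/
theorem openEdges_of_modification {k : ℕ} (hk : 1 ≤ k) {U U' : Clocks d} (hU : Regular U)
    (hU' : WellFounded (Precedes U')) {t a b : unitInterval} (hat : a ≤ t) (hab : a ≤ b)
    {F R : Set (Edge d)} (hRF : R ⊆ F) (hoff : ∀ e ∉ F, U' e = U e)
    (hadj : ∀ e ∉ F, ∀ f ∈ F, Touches e f → a < U e ∧ U e < b)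
    (hR : ∀ e ∈ R, U' e < a) (hFR : ∀ e ∈ F, e ∉ R → b < U' e)
    (hdeg : ∀ v, {f : Edge d | v ∈ f.1 ∧ f ∈ R}.encard ≤ k)
    (hbd : ∀ e ∉ F, ∀ v ∈ e.1, ∀ f ∈ F, v ∈ f.1 → (f ∈ R ↔ f ∈ openEdges k U t)) :
    (∀ e ∈ R, e ∈ openEdges k U' t) ∧
      ∀ e ∉ F, (e ∈ openEdges k U' t ↔ e ∈ openEdges k U t) := by
  obtain ⟨O, hO, -⟩ := existsUnique_isEvolution k U hU.wf
  obtain ⟨O', hO', -⟩ := existsUnique_isEvolution k U' hU'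
  simp only [mem_openEdges_iff hU.wf hO] at hbd ⊢
  simp only [mem_openEdges_iff hU' hO']
  have hdO := hO.degree_le hk hU.inj
  have hOc := (isEvolution_iff hk).1 hO
  have hO'c := (isEvolution_iff hk).1 hO'
  have hremove : ∀ (s : Set (Edge d)) (e : Edge d), e ∈ s → s.encard ≤ k →
      (s \ {e}).encard < k := fun s e he hs => by
    rw [← encard_sdiff_singleton_add_one he] at hs
    exact lt_of_lt_of_le (ENat.lt_add_one_iff (ne_top_of_le_ne_top (ENat.natCast_ne_top k)
      (le_self_add.trans hs)) |>.2 le_rfl) hs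
  -- Only edges of `R` can ring before `e` at its end-vertices, and apart from `e` there are fewer
  -- than `k` of them at each.
  have hRO' : ∀ e ∈ R, e ∈ O' := fun e he => by
    refine (hO'c e).2 fun v hv => ?_
    refine lt_of_le_of_lt (encard_le_encard ?_) (hremove {f | v ∈ f.1 ∧ f ∈ R} e ⟨hv, he⟩ (hdeg v))
    rintro f ⟨hvf, hf, hlt⟩
    refine ⟨⟨hvf, ?_⟩, fun h => (h ▸ hlt).false⟩
    by_contra hfR
    by_cases hfF : f ∈ F
    · exact absurd (hlt.trans (hR e he)) (not_lt.2 (hab.trans (hFR f hfF hfR).le))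
    · have := (hadj f hfF e (hRF he) ⟨v, hvf, hv⟩).1
      rw [← hoff f hfF] at this
      exact absurd (hlt.trans (hR e he)) (not_lt.2 this.le)
  -- Induction along the original clocks, restricted to those up to `t` because `hbd` describes the
  -- boundary only at time `t`.
  have hout : ∀ e, e ∉ F → U e ≤ t → (e ∈ O' ↔ e ∈ O) := fun e => by
    induction e using hU.wf.induction with
    | _ e ih =>
      intro heF het
      constructor
      · intro he
        refine (hOc e).2 fun v hv => lt_of_le_of_lt (encard_le_encard ?_) ((hO'c e).1 he v hv)
        rintro f ⟨hvf, hf, hlt⟩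
        rw [mem_ofPred_eq, hoff e heF]
        by_cases hfF : f ∈ F
        · have hfR := (hbd e heF v hv f hfF hvf).2 ⟨hf, hlt.le.trans het⟩
          exact ⟨hvf, hRO' f hfR, (hR f hfR).trans (hadj e heF f hfF ⟨v, hv, hvf⟩).1⟩
        · rw [hoff f hfF]
          exact ⟨hvf, (ih f ⟨⟨v, hvf, hv⟩, hlt⟩ hfF (hlt.le.trans het)).2 hf, hlt⟩
      · intro he
        -- An edge of `R` may now ring before `e` although it used to ring after, so the old degree
        -- just before `U e` is not enough. The bound `k` on the final degree, with `e` itself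
        -- removed, still is.
        refine (hO'c e).2 fun v hv =>
          lt_of_le_of_lt (encard_le_encard ?_) (hremove {f | v ∈ f.1 ∧ f ∈ O} e ⟨hv, he⟩ (hdO v))
        rintro f ⟨hvf, hf, hlt⟩
        refine ⟨⟨hvf, ?_⟩, fun h => (h ▸ hlt).false⟩
        rw [hoff e heF] at hlt
        by_cases hfF : f ∈ F
        · by_cases hfR : f ∈ R
          · exact ((hbd e heF v hv f hfF hvf).1 hfR).1
          · have := (hadj e heF f hfF ⟨v, hv, hvf⟩).2
            exact absurd (hlt.trans this) (not_lt.2 (hFR f hfF hfR).le)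
        · rw [hoff f hfF] at hlt
          exact (ih f ⟨⟨v, hvf, hv⟩, hlt⟩ hfF (hlt.le.trans het)).1 hf
  refine ⟨fun e he => ⟨hRO' e he, (hR e he).le.trans hat⟩, fun e he => ?_⟩
  rw [hoff e he]
  exact and_congr_left fun h => hout e he h

open Classical in
/-- The clocks `V` on `F` and the clocks `U` elsewhere. -/
noncomputable def overlay (F : Set (Edge d)) (U V : Clocks d) : Clocks d :=
  fun e => if e ∈ F then V e else U e

/-- Resampling the clocks in `F` from an independent copy preserves the law, so positivity for the
pair of clock families passes to the modified clocks. -/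
theorem measurePreserving_overlay (F : Set (Edge d)) :
    MeasurePreserving (fun p : Clocks d × Clocks d => overlay F p.1 p.2)
      ((clockMeasure d).prod (clockMeasure d)) (clockMeasure d) := by
  classical
  have hm : Measurable (fun p : Clocks d × Clocks d => overlay F p.1 p.2) := by
    refine measurable_pi_lambda _ fun e => ?_
    unfold overlay
    by_cases h : e ∈ F <;> simp only [h, if_true, if_false] <;> fun_prop
  refine ⟨hm, Measure.eq_infinitePi _ fun s t ht => ?_⟩
  rw [Measure.map_apply hm (.pi s.countable_toSet fun _ _ => ht _)]
  have : (fun p : Clocks d × Clocks d => overlay F p.1 p.2) ⁻¹' (s : Set (Edge d)).pi t =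
      (Set.pi (s.filter (· ∉ F) : Finset (Edge d)) t) ×ˢ
        (Set.pi (s.filter (· ∈ F) : Finset (Edge d)) t) := by
    ext ⟨U, V⟩
    simp only [overlay, mem_preimage, Set.mem_pi, mem_prod, Finset.coe_filter, mem_ofPred_eq,
      Finset.mem_coe]
    constructor
    · refine fun h => ⟨fun e he => ?_, fun e he => ?_⟩
      · simpa [he.2] using h e he.1
      · simpa [he.2] using h e he.1
    · rintro ⟨h1, h2⟩ e he
      by_cases heF : e ∈ F
      · simpa [heF] using h2 e ⟨he, heF⟩
      · simpa [heF] using h1 e ⟨he, heF⟩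
  rw [this, Measure.prod_prod, clockMeasure, Measure.infinitePi_pi _ fun _ _ => ht _,
    Measure.infinitePi_pi _ fun _ _ => ht _, mul_comm,
    Finset.prod_filter_mul_prod_filter_not]

/-- A threshold close to `0`. -/
noncomputable def earlyTime (m : ℕ) : unitInterval :=
  ⟨1 / (m + 2), by positivity, by rw [div_le_one (by positivity)]; linarith [m.cast_nonneg (α := ℝ)]⟩

theorem eventually_earlyTime_lt {c : unitInterval} (hc : 0 < c) :
    ∀ᶠ m in Filter.atTop, earlyTime m < c := by
  filter_upwards [Filter.eventually_gt_atTop ⌈1 / (c : ℝ)⌉₊] with m hm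
  have hc' : (0 : ℝ) < c := hc
  have h1 : 1 / (c : ℝ) < m := (Nat.le_ceil _).trans_lt (by exact_mod_cast hm)
  change (1 : ℝ) / (m + 2) < c
  rw [div_lt_iff₀ hc'] at h1
  rw [div_lt_iff₀ (by positivity)]
  nlinarith

theorem eventually_lt_symm_earlyTime {c : unitInterval} (hc : c < 1) :
    ∀ᶠ m in Filter.atTop, c < unitInterval.symm (earlyTime m) := by
  have : 0 < unitInterval.symm c := by
    change (0 : ℝ) < 1 - c
    have : (c : ℝ) < 1 := hc
    linarith
  filter_upwards [eventually_earlyTime_lt this] with m hm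
  change (c : ℝ) < 1 - earlyTime m
  have : (earlyTime m : ℝ) < 1 - c := hm
  linarith

/-- The offset `2` in the denominator of `earlyTime` keeps the threshold at most `1/2`. -/
theorem earlyTime_le_symm (m : ℕ) : earlyTime m ≤ unitInterval.symm (earlyTime m) := by
  change (1 : ℝ) / (m + 2) ≤ 1 - 1 / (m + 2)
  have : (1 : ℝ) / (m + 2) ≤ 1 / 2 := by
    apply one_div_le_one_div_of_le <;> linarith [m.cast_nonneg (α := ℝ)]
  linarith

/-- Clocks that ring early on `R` and late on the rest of `F`. -/
def window (F R : Finset (Edge d)) (m : ℕ) : Set (Clocks d) :=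
  {V | ∀ e ∈ F, (e ∈ R → V e < earlyTime m) ∧ (e ∉ R → unitInterval.symm (earlyTime m) < V e)}

theorem clockMeasure_window_ne_zero (F R : Finset (Edge d)) (m : ℕ) :
    clockMeasure d (window F R m) ≠ 0 := by
  classical
  have h0 : (0 : ℝ) < earlyTime m := by unfold earlyTime; positivity
  have hpi := Measure.infinitePi_pi (fun _ : Edge d => (volume : Measure unitInterval)) (s := F)
    (t := fun e => if e ∈ R then Iio (earlyTime m) else Ioi (unitInterval.symm (earlyTime m)))
    (fun e _ => by split_ifs <;> measurability)
  have hsub : (F : Set (Edge d)).pi (fun e => if e ∈ R then Iio (earlyTime m) else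
      Ioi (unitInterval.symm (earlyTime m))) ⊆ window F R m := fun V hV e he => by
    have := hV e he
    dsimp only at this
    split_ifs at this with h
    · exact ⟨fun _ => this, fun h' => absurd h h'⟩
    · exact ⟨fun h' => absurd h' h, fun _ => this⟩
  refine fun hzero => ?_
  have h1 := measure_mono_null hsub hzero
  rw [clockMeasure, hpi, Finset.prod_eq_zero_iff] at h1
  obtain ⟨e, -, he⟩ := h1
  split_ifs at he
  · rw [unitInterval.volume_Iio, ENNReal.ofReal_eq_zero] at he
    linarith
  · rw [unitInterval.volume_Ioi, ENNReal.ofReal_eq_zero, unitInterval.coe_symm_eq] at he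
    linarith

/-- The lattice edges that may be used to rewire `G` on `D`: those inside `D`, and those of `G`
that touch `D`. -/
def patch (G : SimpleGraph (Fin d → ℤ)) (D : Finset (Fin d → ℤ)) : SimpleGraph (Fin d → ℤ) where
  Adj x y := (lattice d).Adj x y ∧ ((x ∈ D ∧ y ∈ D) ∨ (G.Adj x y ∧ (x ∈ D ∨ y ∈ D)))
  symm := ⟨fun x y h => by
    refine ⟨h.1.symm, h.2.imp And.symm fun h => ⟨h.1.symm, h.2.symm⟩⟩⟩
  loopless := ⟨fun x h => h.1.ne rfl⟩

/-- The set `D` together with the adjacent sites. -/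
def nbhd (D : Finset (Fin d → ℤ)) : Set (Fin d → ℤ) :=
  {v | v ∈ D ∨ ∃ w ∈ D, (lattice d).Adj v w}

theorem subset_nbhd (D : Finset (Fin d → ℤ)) : (D : Set (Fin d → ℤ)) ⊆ nbhd D :=
  fun _ h => Or.inl h

theorem nbhd_finite (D : Finset (Fin d → ℤ)) : (nbhd D).Finite := by
  have : nbhd D ⊆ D ∪ ⋃ w ∈ D, (lattice d).neighborSet w := by
    rintro v (h | ⟨w, hw, h⟩)
    · exact Or.inl h
    · exact Or.inr (mem_biUnion hw h.symm)
  exact (D.finite_toSet.union (D.finite_toSet.biUnion fun w _ =>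
    lattice_neighborSet_finite w)).subset this

/-- `G'` arises from `G` by rewiring on `D` so that the edges of `H` are present. -/
structure Rewired (k : ℕ) (G H G' : SimpleGraph (Fin d → ℤ)) (D : Finset (Fin d → ℤ)) : Prop where
  le_lattice : G' ≤ lattice d
  degree_le : ∀ v, (G'.neighborSet v).encard ≤ k
  le : H ≤ G'
  adj_of_notMem : ∀ x y, x ∉ D → y ∉ D → G.Adj x y → G'.Adj x y
  adj_iff : ∀ x y, x ∉ nbhd D → y ∉ nbhd D → (G'.Adj x y ↔ G.Adj x y)

/-- Realises a rewiring of graphs by clocks. `F` consists of the edges meeting `nbhd D`, and `R` of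
the edges of `H` and the open edges of `F` that avoid `D`. An edge of `F` with an end-vertex outside
`nbhd D` cannot touch `D`, so near the boundary `R` is exactly the old open set. Finally `m` is
taken so large that the thresholds beat the finitely many clocks near `F`. -/
theorem exists_window_rewired {k : ℕ} (hk : 1 ≤ k) {t : unitInterval} (ht : 0 < t) {U : Clocks d}
    (hU : Regular U) {D : Finset (Fin d → ℤ)} {H : SimpleGraph (Fin d → ℤ)}
    (hH : H ≤ patch (openGraph k U t) D) (hdeg : ∀ v ∈ D, (H.neighborSet v).encard ≤ k) :
    ∃ (F R : Finset (Edge d)) (m : ℕ), ∀ V ∈ window F R m, Regular (overlay (F : Set (Edge d)) U V) →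
      Rewired k (openGraph k U t) H (openGraph k (overlay (F : Set (Edge d)) U V) t) D := by
  obtain ⟨O, hO, -⟩ := existsUnique_isEvolution k U hU.wf
  have hFfin : {e : Edge d | ∃ v ∈ nbhd D, v ∈ e.1}.Finite := by
    have := (nbhd_finite D).biUnion fun v _ => edges_at_finite v
    refine this.subset ?_
    rintro e ⟨v, hv, hve⟩
    exact mem_biUnion hv hve
  set F : Set (Edge d) := {e | ∃ v ∈ nbhd D, v ∈ e.1} with hF
  set R : Set (Edge d) := {e | e.1 ∈ H.edgeSet} ∪
    {e | e ∈ F ∧ e ∈ openEdges k U t ∧ ∀ v ∈ e.1, v ∉ D} with hR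
  have hHF : ∀ e : Edge d, e.1 ∈ H.edgeSet → e ∈ F := by
    rintro ⟨⟨x, y⟩, hxy⟩ he
    rcases (hH he).2 with h | h
    · exact ⟨x, Or.inl h.1, Sym2.mem_mk_left x y⟩
    · rcases h.2 with h | h
      · exact ⟨x, Or.inl h, Sym2.mem_mk_left x y⟩
      · exact ⟨y, Or.inl h, Sym2.mem_mk_right x y⟩
  have hRF : R ⊆ F := by
    rintro e (h | h)
    · exact hHF e h
    · exact h.1
  have hRopen : ∀ f ∈ R, ∀ v ∈ f.1, v ∉ D → f ∈ openEdges k U t := by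
    rintro f (h | h) v hv hvD
    · obtain ⟨w, hvw, rfl⟩ := exists_eq_mkEdge hv
      rcases (hH h).2 with h | h
      · exact absurd h.1 hvD
      · exact (openGraph_adj_iff.1 h.1).2
    · exact h.2.1
  have hRdeg : ∀ v, {f : Edge d | v ∈ f.1 ∧ f ∈ R}.encard ≤ k := by
    intro v
    by_cases hv : v ∈ D
    · refine le_trans ?_ (hdeg v hv)
      have hinj : InjOn (fun w => s(v, w)) (H.neighborSet v) :=
        fun a _ b _ h => Sym2.congr_right.1 h
      rw [← hinj.encard_image, ← Subtype.val_injective.injOn.encard_image]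
      refine encard_le_encard ?_
      rintro _ ⟨f, ⟨hvf, hf⟩, rfl⟩
      rcases hf with hf | hf
      · obtain ⟨w, hvw, rfl⟩ := exists_eq_mkEdge hvf
        exact ⟨w, hf, rfl⟩
      · exact absurd hv (hf.2.2 v hvf)
    · refine le_trans (encard_le_encard ?_) (hO.degree_le hk hU.inj v)
      rintro f ⟨hvf, hf⟩
      exact ⟨hvf, ((mem_openEdges_iff hU.wf hO).1 (hRopen f hf v hvf hv)).1⟩
  have hbd : ∀ e ∉ F, ∀ v ∈ e.1, ∀ f ∈ F, v ∈ f.1 → (f ∈ R ↔ f ∈ openEdges k U t) := by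
    intro e he v hv f hf hvf
    have hvn : v ∉ nbhd D := fun h => he ⟨v, h, hv⟩
    have hvD : v ∉ D := fun h => hvn (Or.inl h)
    refine ⟨fun h => hRopen f h v hvf hvD, fun h => Or.inr ⟨hf, h, fun w hw hwD => ?_⟩⟩
    obtain ⟨w', hvw, rfl⟩ := exists_eq_mkEdge hvf
    rcases Sym2.mem_iff.1 hw with rfl | rfl
    · exact hvD hwD
    · exact hvn (Or.inr ⟨w, hwD, hvw⟩)
  have hadjfin : {e : Edge d | ∃ f ∈ F, Touches e f}.Finite := by
    refine (hFfin.biUnion fun f _ => touches_finite f).subset ?_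
    rintro e ⟨f, hf, h⟩
    exact mem_biUnion hf h
  obtain ⟨m, hmt, hm⟩ : ∃ m, earlyTime m < t ∧ ∀ e ∈ {e : Edge d | ∃ f ∈ F, Touches e f},
      earlyTime m < U e ∧ U e < unitInterval.symm (earlyTime m) :=
    ((eventually_earlyTime_lt ht).and ((Filter.eventually_all_finite hadjfin).2 fun e _ =>
      (eventually_earlyTime_lt (hU.pos e)).and (eventually_lt_symm_earlyTime (hU.lt_one e)))).exists
  refine ⟨hFfin.toFinset, (hFfin.subset hRF).toFinset, m, fun V hV hreg => ?_⟩
  rw [Finite.coe_toFinset] at hreg ⊢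
  have hV' : ∀ e ∈ F, (e ∈ R → V e < earlyTime m) ∧
      (e ∉ R → unitInterval.symm (earlyTime m) < V e) := fun e he => by
    have := hV e (hFfin.mem_toFinset.2 he)
    rwa [Finite.mem_toFinset] at this
  obtain ⟨h1, h2⟩ := openEdges_of_modification hk hU hreg.wf hmt.le (earlyTime_le_symm m) hRF
    (fun e he => by simp [overlay, he])
    (fun e _ f hf h => hm e ⟨f, hf, h⟩)
    (fun e he => by simpa [overlay, hRF he] using (hV' e (hRF he)).1 he)
    (fun e he he' => by simpa [overlay, he] using (hV' e he).2 he') hRdeg hbd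
  refine ⟨openGraph_le, openGraph_degree_le hk hreg t, fun x y h => ?_, fun x y hx hy h => ?_,
    fun x y hx hy => ?_⟩
  · have hxy := (hH h).1
    exact openGraph_adj_iff.2 ⟨hxy, h1 (mkEdge hxy) (Or.inl h)⟩
  · obtain ⟨hxy, ho⟩ := openGraph_adj_iff.1 h
    refine openGraph_adj_iff.2 ⟨hxy, ?_⟩
    by_cases he : mkEdge hxy ∈ F
    · refine h1 _ (Or.inr ⟨he, ho, fun v hv => ?_⟩)
      rcases Sym2.mem_iff.1 hv with rfl | rfl
      · exact hx
      · exact hy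
    · exact (h2 _ he).2 ho
  · simp only [openGraph_adj_iff]
    refine exists_congr fun hxy => h2 _ ?_
    rintro ⟨v, hv, hv'⟩
    rcases Sym2.mem_iff.1 hv' with rfl | rfl
    · exact hx hv
    · exact hy hv

/-- Local modification: if with positive probability the open graph can be rewired locally to a graph
with property `Q`, then `Q` has positive probability. -/
theorem surgery {k : ℕ} (hk : 1 ≤ k) {t : unitInterval} (ht : 0 < t) {P : Set (Clocks d)}
    {Q : SimpleGraph (Fin d → ℤ) → Prop} (hP : clockMeasure d P ≠ 0)
    (h : ∀ᵐ U ∂clockMeasure d, U ∈ P → ∃ (D : Finset (Fin d → ℤ)) (H : SimpleGraph (Fin d → ℤ)),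
      H ≤ patch (openGraph k U t) D ∧ (∀ v ∈ D, (H.neighborSet v).encard ≤ k) ∧
      ∀ G', Rewired k (openGraph k U t) H G' D → Q G') :
    clockMeasure d {U | Q (openGraph k U t)} ≠ 0 := by
  set A : Finset (Edge d) × Finset (Edge d) × ℕ → Set (Clocks d) := fun p =>
    {U | ∀ V ∈ window p.1 p.2.1 p.2.2, Regular (overlay (p.1 : Set (Edge d)) U V) →
      Q (openGraph k (overlay (p.1 : Set (Edge d)) U V) t)} with hA
  -- The rewiring depends on `U`, but there are only countably many triples, so a single one works
  -- with positive outer measure.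
  obtain ⟨⟨F, R, m⟩, hp⟩ : ∃ p, clockMeasure d (A p) ≠ 0 := by
    by_contra! hcon
    refine hP (measure_mono_null_ae (t := ⋃ p, A p) ?_ (measure_iUnion_null hcon))
    filter_upwards [h, ae_regular d] with U hU hreg hUP
    obtain ⟨D, H, hH, hdeg, hQ⟩ := hU hUP
    obtain ⟨F, R, m, hw⟩ := exists_window_rewired hk ht hreg hH hdeg
    exact mem_iUnion.2 ⟨(F, R, m), fun V hV hr => hQ _ (hw V hV hr)⟩
  intro hzero
  -- `A` is not known to be measurable; the product formula for rectangles holds for arbitrary sets.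
  have hpos : ((clockMeasure d).prod (clockMeasure d)) (A (F, R, m) ×ˢ window F R m) ≠ 0 := by
    rw [Measure.prod_prod]
    exact mul_ne_zero hp (clockMeasure_window_ne_zero F R m)
  refine hpos ?_
  have hq := (measurePreserving_overlay (F : Set (Edge d))).quasiMeasurePreserving
  refine measure_mono_null_ae ?_ (hq.preimage_null hzero)
  filter_upwards [hq.ae (ae_regular d)] with p hreg hpA
  exact hpA.1 p.2 hpA.2 hreg

end CDP

/-! ### Deterministic graph theory: restrictions, infinite parts, small trees, boxes. -/

namespace CDP

section Graph

variable {V : Type*} {G G' : SimpleGraph V} {s t : Set V}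

/-- The graph `G` without the edges that leave `s`. -/
def within (G : SimpleGraph V) (s : Set V) : SimpleGraph V where
  Adj x y := G.Adj x y ∧ x ∈ s ∧ y ∈ s
  symm := ⟨fun _ _ h => ⟨h.1.symm, h.2.2, h.2.1⟩⟩
  loopless := ⟨fun _ h => h.1.ne rfl⟩

theorem within_le (G : SimpleGraph V) (s : Set V) : within G s ≤ G := fun _ _ h => h.1

theorem within_mono (h : G ≤ G') (hst : s ⊆ t) : within G s ≤ within G' t :=
  fun _ _ hxy => ⟨h hxy.1, hst hxy.2.1, hst hxy.2.2⟩

theorem within_within : within (within G s) t = within G (s ∩ t) := by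
  ext x y
  simp only [within, mem_inter_iff]
  tauto

theorem mem_of_reachable_within {x y : V} (h : (within G s).Reachable x y) (hx : x ∈ s) :
    y ∈ s := by
  obtain ⟨p⟩ := h
  induction p with
  | nil => exact hx
  | cons h p ih => exact ih h.2.2

theorem reachable_within_of_forall {x y : V} (h : G.Reachable x y)
    (hs : ∀ w, G.Reachable x w → w ∈ s) : (within G s).Reachable x y := by
  obtain ⟨p⟩ := h
  induction p with
  | nil => rfl
  | @cons u v w h p ih =>
    have h' : (within G s).Adj u v := ⟨h, hs _ .rfl, hs _ h.reachable⟩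
    exact h'.reachable.trans (ih fun w hw => hs w (h.reachable.trans hw))

theorem exists_first_hit {x y : V} (h : G.Reachable x y) (hx : x ∉ s) (hy : y ∈ s) :
    ∃ u c, u ∉ s ∧ c ∈ s ∧ G.Adj u c ∧ (within G sᶜ).Reachable x u := by
  obtain ⟨p⟩ := h
  induction p with
  | nil => exact absurd hy hx
  | @cons u v w h p ih =>
    by_cases hv : v ∈ s
    · exact ⟨u, v, hx, hv, h, .rfl⟩
    · obtain ⟨a, c, ha, hc, hac, hr⟩ := ih hv hy
      have h' : (within G sᶜ).Adj u v := ⟨h, hx, hv⟩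
      exact ⟨a, c, ha, hc, hac, h'.reachable.trans hr⟩

theorem exists_path_first_hit {x y : V} (h : G.Reachable x y) (hy : y ∈ s) :
    ∃ c ∈ s, ∃ p : G.Walk x c, p.IsPath ∧ ∀ v ∈ p.support, v ∈ s → v = c := by
  classical
  suffices h : ∃ c ∈ s, ∃ p : G.Walk x c, ∀ v ∈ p.support, v ∈ s → v = c by
    obtain ⟨c, hc, p, hp⟩ := h
    exact ⟨c, hc, p.bypass, p.bypass_isPath, fun v hv => hp v (p.support_bypass_subset_support hv)⟩
  obtain ⟨p⟩ := h
  induction p with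
  | nil => exact ⟨_, hy, .nil, by simp⟩
  | @cons u v w h p ih =>
    by_cases hu : u ∈ s
    · exact ⟨u, hu, .nil, by simp⟩
    · obtain ⟨c, hc, q, hq⟩ := ih hy
      refine ⟨c, hc, .cons h q, fun a ha has => ?_⟩
      rw [SimpleGraph.Walk.support_cons, List.mem_cons] at ha
      rcases ha with rfl | ha
      · exact absurd has hu
      · exact hq a ha has

/-- Removing a finite set of vertices from an infinite cluster of a locally finite graph leaves an
infinite cluster. -/
theorem exists_infinite_within_compl (hG : ∀ v, (G.neighborSet v).Finite) {D : Set V}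
    (hD : D.Finite) {x : V} (hx : {y | G.Reachable x y}.Infinite) :
    ∃ u ∉ D, G.Reachable x u ∧ {y | (within G Dᶜ).Reachable u y}.Infinite ∧
      (u = x ∨ ∃ z ∈ D, G.Adj u z) := by
  by_contra! hcon
  refine hx ?_
  -- Every site of the cluster outside `D` is joined off `D` to some site of `N`: follow a walk
  -- towards `x` until it reaches `x` or is about to enter `D`. As `N` is finite, one of these
  -- components is infinite.
  set N : Set V := {u | u ∉ D ∧ G.Reachable x u ∧ (u = x ∨ ∃ z ∈ D, G.Adj u z)}
  have hN : N.Finite := by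
    refine ((finite_singleton x).union (hD.biUnion fun z _ => hG z)).subset ?_
    rintro u ⟨-, -, rfl | ⟨z, hz, h⟩⟩
    · exact Or.inl rfl
    · exact Or.inr (mem_biUnion hz h.symm)
  refine (hD.union (hN.biUnion (t := fun u => {y | (within G Dᶜ).Reachable u y}) ?_)).subset ?_
  · rintro u ⟨h1, h2, h3⟩
    by_contra hinf
    have := hcon u h1 h2 hinf
    rcases h3 with h3 | ⟨z, hz, h3⟩
    · exact this.1 h3
    · exact this.2 z hz h3
  · intro y hy
    by_cases hyD : y ∈ D
    · exact Or.inl hyD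
    refine Or.inr ?_
    by_cases hyx : y = x
    · subst hyx
      exact mem_biUnion (show y ∈ N from ⟨hyD, .rfl, Or.inl rfl⟩) (.rfl)
    obtain ⟨u, c, hu, hc, huc, hr⟩ := exists_first_hit (s := insert x D)
      (SimpleGraph.Reachable.symm hy) (fun h => h.elim hyx hyD) (mem_insert x D)
    have hr' : (within G Dᶜ).Reachable y u :=
      hr.mono (within_mono le_rfl (compl_subset_compl.2 (subset_insert x D)))
    have huD : u ∉ D := fun h => hu (Or.inr h)
    rcases hc with rfl | hc
    · have hcD : c ∈ Dᶜ ∨ c ∈ D := (em (c ∈ D)).symm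
      rcases hcD with hcD | hcD
      · have h' : (within G Dᶜ).Adj u c := ⟨huc, huD, hcD⟩
        exact mem_biUnion (show c ∈ N from ⟨hcD, .rfl, Or.inl rfl⟩)
          (hr'.trans h'.reachable).symm
      · exact mem_biUnion (show u ∈ N from ⟨huD, hy.trans (hr'.mono (within_le _ _)),
          Or.inr ⟨c, hcD, huc⟩⟩) hr'.symm
    · exact mem_biUnion (show u ∈ N from ⟨huD, SimpleGraph.Reachable.trans hy
        (hr'.mono (within_le _ _)), Or.inr ⟨c, hc, huc⟩⟩) hr'.symm

theorem neighborSet_toSubgraph_encard_le_one {x y : V} {p : G.Walk x y} (hp : p.IsPath) :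
    (p.toSubgraph.neighborSet y).encard ≤ 1 := by
  by_cases hn : p.Nil
  · cases hn
    simp [SimpleGraph.Subgraph.neighborSet]
  · rw [hp.neighborSet_toSubgraph_endpoint hn, encard_singleton]

theorem neighborSet_toSubgraph_eq_empty {x y v : V} {p : G.Walk x y} (hv : v ∉ p.support) :
    p.toSubgraph.neighborSet v = ∅ := by
  ext w
  simp only [SimpleGraph.Subgraph.mem_neighborSet, mem_empty_iff_false, iff_false]
  intro h
  exact hv (by simpa using h.fst_mem)

theorem neighborSet_toSubgraph_encard_le_two {x y : V} {p : G.Walk x y} (hp : p.IsPath) (v : V) :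
    (p.toSubgraph.neighborSet v).encard ≤ 2 := by
  by_cases hv : v ∈ p.support
  · obtain ⟨i, rfl, hi⟩ := SimpleGraph.Walk.mem_support_iff_exists_getVert.1 hv
    rcases Nat.eq_zero_or_pos i with rfl | hi0
    · have := neighborSet_toSubgraph_encard_le_one hp.reverse
      rw [SimpleGraph.Walk.toSubgraph_reverse] at this
      rw [SimpleGraph.Walk.getVert_zero]
      exact this.trans (by norm_num)
    · rcases hi.lt_or_eq with hi | rfl
      · rw [hp.neighborSet_toSubgraph_internal hi0.ne' hi]
        exact (encard_insert_le _ _).trans (by rw [encard_singleton]; norm_num)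
      · rw [SimpleGraph.Walk.getVert_length]
        exact (neighborSet_toSubgraph_encard_le_one hp).trans (by norm_num)
  · rw [neighborSet_toSubgraph_eq_empty hv]; simp

theorem reachable_toSubgraph {x y : V} (p : G.Walk x y) :
    p.toSubgraph.spanningCoe.Reachable x y := by
  have := p.toSubgraph_connected
  have h := this.coe.preconnected
    ⟨x, p.start_mem_verts_toSubgraph⟩ ⟨y, p.end_mem_verts_toSubgraph⟩
  exact h.map (⟨fun v => v.1, fun h => h⟩ : p.toSubgraph.coe →g p.toSubgraph.spanningCoe)

/-- Two connected vertices are connected by a path. -/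
theorem exists_subgraph_two {x y : V} (h : G.Reachable x y) :
    ∃ H ≤ G, H.Reachable x y ∧ ∀ v, (H.neighborSet v).encard ≤ 2 := by
  obtain ⟨p, hp⟩ := h.exists_isPath
  exact ⟨p.toSubgraph.spanningCoe, p.toSubgraph.spanningCoe_le, reachable_toSubgraph p,
    neighborSet_toSubgraph_encard_le_two hp⟩

/-- Three connected vertices are connected by a tree of maximal degree at most three. -/
theorem exists_subgraph_three {x y z : V} (hxy : G.Reachable x y) (hzx : G.Reachable z x) :
    ∃ H ≤ G, H.Reachable x y ∧ H.Reachable z x ∧ ∀ v, (H.neighborSet v).encard ≤ 3 := by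
  obtain ⟨p, hp⟩ := hxy.exists_isPath
  obtain ⟨c, hc, q, hq, hqp⟩ := exists_path_first_hit (s := {v | v ∈ p.support}) hzx
    p.start_mem_support
  refine ⟨p.toSubgraph.spanningCoe ⊔ q.toSubgraph.spanningCoe,
    sup_le p.toSubgraph.spanningCoe_le q.toSubgraph.spanningCoe_le,
    (reachable_toSubgraph p).mono le_sup_left, ?_, fun v => ?_⟩
  · refine ((reachable_toSubgraph q).mono le_sup_right).trans ?_
    classical
    have h := reachable_toSubgraph (p.takeUntil c hc)
    refine (h.mono ?_).symm
    refine le_trans ?_ le_sup_left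
    intro a b hab
    rw [SimpleGraph.Subgraph.spanningCoe_adj, SimpleGraph.Walk.adj_toSubgraph_iff_mem_edges] at hab ⊢
    exact p.edges_takeUntil_subset_edges hc hab
  · have hun : (p.toSubgraph.spanningCoe ⊔ q.toSubgraph.spanningCoe).neighborSet v =
        p.toSubgraph.neighborSet v ∪ q.toSubgraph.neighborSet v := rfl
    rw [hun]
    refine (encard_union_le _ _).trans ?_
    by_cases hv : v ∈ p.support
    · by_cases hvc : v = c
      · subst hvc
        calc _ ≤ (2 : ℕ∞) + 1 := add_le_add (neighborSet_toSubgraph_encard_le_two hp v)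
              (neighborSet_toSubgraph_encard_le_one hq)
          _ = 3 := by norm_num
      · rw [neighborSet_toSubgraph_eq_empty (p := q) fun h => hvc (hqp v h hv), encard_empty,
          add_zero]
        exact (neighborSet_toSubgraph_encard_le_two hp v).trans (by norm_num)
    · rw [neighborSet_toSubgraph_eq_empty hv, encard_empty, zero_add]
      exact (neighborSet_toSubgraph_encard_le_two hq v).trans (by norm_num)

/-- In a graph of maximal degree two, a cluster with two vertices of degree one is finite. -/
theorem finite_of_two_endpoints (hG : ∀ v, (G.neighborSet v).encard ≤ 2) {x y : V} (hxy : x ≠ y)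
    (h : G.Reachable x y) (hx : (G.neighborSet x).encard ≤ 1) (hy : (G.neighborSet y).encard ≤ 1) :
    {z | G.Reachable x z}.Finite := by
  obtain ⟨p, hp⟩ := h.exists_isPath
  have hn : ¬ p.Nil := fun hn => hxy hn.eq
  -- The path already uses every edge of `G` at each of its vertices, so its support is closed under
  -- adjacency and is the whole cluster.
  have hle : ∀ v ∈ p.support, (G.neighborSet v).encard ≤ (p.toSubgraph.neighborSet v).encard := by
    intro v hv
    obtain ⟨i, rfl, hi⟩ := SimpleGraph.Walk.mem_support_iff_exists_getVert.1 hv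
    rcases Nat.eq_zero_or_pos i with rfl | hi0
    · rw [SimpleGraph.Walk.getVert_zero, hp.neighborSet_toSubgraph_startpoint hn,
        encard_singleton]
      exact hx
    · rcases hi.lt_or_eq with hi | rfl
      · refine (hG _).trans ?_
        have := hp.ncard_neighborSet_toSubgraph_internal_eq_two hi0.ne' hi
        rw [← Set.Finite.cast_ncard_eq (finite_of_ncard_ne_zero (by omega)), this]
        norm_num
      · rw [SimpleGraph.Walk.getVert_length, hp.neighborSet_toSubgraph_endpoint hn,
          encard_singleton]
        exact hy
  refine (List.finite_toSet p.support).subset ?_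
  rintro z ⟨q⟩
  have key : ∀ {a b : V} (q : G.Walk a b), a ∈ p.support → b ∈ p.support := by
    intro a b q
    induction q with
    | nil => exact id
    | @cons u v w huv q ih =>
      refine fun hu => ih ?_
      have hfin : (G.neighborSet u).Finite :=
        finite_of_encard_le_coe (k := 2) (by exact_mod_cast hG u)
      have heq := Set.Finite.eq_of_subset_of_encard_le
        (hfin.subset (p.toSubgraph.neighborSet_subset u)) (p.toSubgraph.neighborSet_subset u)
        (hle u hu)
      have : v ∈ p.toSubgraph.neighborSet u := by rw [heq]; exact huv
      simpa using p.toSubgraph.edge_vert this.symm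
  exact key q p.start_mem_support

end Graph

/-- Moving one coordinate a unit towards `y` stays in the box. The box may be degenerate, so faces
of cubes are covered. -/
theorem box_reachable {d : ℕ} {a b x y : Fin d → ℤ} (hx : x ∈ Icc a b) (hy : y ∈ Icc a b) :
    (within (lattice d) (Icc a b)).Reachable x y := by
  obtain ⟨n, hn⟩ : ∃ n : ℕ, ∑ i, (x i - y i).natAbs = n := ⟨_, rfl⟩
  induction n using Nat.strong_induction_on generalizing x with
  | _ n ih =>
    by_cases hxy : x = y
    · rw [hxy]
    obtain ⟨i, hi⟩ := Function.ne_iff.1 hxy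
    obtain ⟨c, hc1, hc2, hc3, hc4⟩ : ∃ c : ℤ, |x i - c| = 1 ∧ a i ≤ c ∧ c ≤ b i ∧
        (c - y i).natAbs < (x i - y i).natAbs := by
      have h1 : a i ≤ x i := hx.1 i
      have h2 : x i ≤ b i := hx.2 i
      have h3 : a i ≤ y i := hy.1 i
      have h4 : y i ≤ b i := hy.2 i
      rcases lt_or_gt_of_ne hi with h | h
      · exact ⟨x i + 1, by simp, by omega, by omega, by omega⟩
      · exact ⟨x i - 1, by simp, by omega, by omega, by omega⟩
    set x' := Function.update x i c with hx'
    have hmem : x' ∈ Icc a b := by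
      constructor <;> intro j <;> by_cases hj : j = i
      · subst hj; simpa [hx'] using hc2
      · simpa [hx', hj] using hx.1 j
      · subst hj; simpa [hx'] using hc3
      · simpa [hx', hj] using hx.2 j
    have hadj : (lattice d).Adj x x' := by
      change ∑ j, |x j - x' j| = 1
      rw [Finset.sum_eq_single i]
      · simpa [hx'] using hc1
      · intro j _ hj
        simp [hx', hj]
      · simp
    have hlt : ∑ j, (x' j - y j).natAbs < n := by
      rw [← hn]
      refine Finset.sum_lt_sum (fun j _ => ?_) ⟨i, Finset.mem_univ i, by simpa [hx'] using hc4⟩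
      by_cases hj : j = i
      · subst hj; simpa [hx'] using hc4.le
      · simp [hx', hj]
    have h' : (within (lattice d) (Icc a b)).Adj x x' := ⟨hadj, hx, hmem⟩
    exact h'.reachable.trans (ih _ hlt hmem rfl)

/-! ### Counting disjoint trifurcating sets. -/

section Count

variable {V ι : Type*} {G : SimpleGraph V}

/-- Removing the connected set `Y` separates its cluster into at least three parts that meet `S`. -/
structure Trifurcates (G : SimpleGraph V) (S Y : Set V) : Prop where
  connected : ∀ a ∈ Y, ∀ b ∈ Y, (within G Y).Reachable a b
  exists_three : ∃ s₁ ∈ S, ∃ s₂ ∈ S, ∃ s₃ ∈ S,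
    (s₁ ∉ Y ∧ s₂ ∉ Y ∧ s₃ ∉ Y) ∧
    ((∃ y ∈ Y, G.Reachable s₁ y) ∧ (∃ y ∈ Y, G.Reachable s₂ y) ∧ ∃ y ∈ Y, G.Reachable s₃ y) ∧
    ¬ (within G Yᶜ).Reachable s₁ s₂ ∧ ¬ (within G Yᶜ).Reachable s₁ s₃ ∧
    ¬ (within G Yᶜ).Reachable s₂ s₃

/-- Witnesses may be moved within their components off `Y`; this lets the set of end-points shrink
in the induction below. -/
theorem Trifurcates.replace {S S' Y : Set V} (h : Trifurcates G S Y) (g : V → V)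
    (hS : ∀ s ∈ S, g s ∈ S') (hY : ∀ s, s ∉ Y → g s ∉ Y)
    (hg : ∀ s, (within G Yᶜ).Reachable s (g s)) : Trifurcates G S' Y := by
  obtain ⟨h0, s₁, h1, s₂, h2, s₃, h3, ⟨a1, a2, a3⟩, ⟨⟨y1, b1, c1⟩, ⟨y2, b2, c2⟩, y3, b3, c3⟩,
    d1, d2, d3⟩ := h
  have hg' : ∀ s, G.Reachable (g s) s := fun s => ((hg s).mono (within_le _ _)).symm
  refine ⟨h0, g s₁, hS _ h1, g s₂, hS _ h2, g s₃, hS _ h3, ⟨hY _ a1, hY _ a2, hY _ a3⟩,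
    ⟨⟨y1, b1, (hg' _).trans c1⟩, ⟨y2, b2, (hg' _).trans c2⟩, y3, b3, (hg' _).trans c3⟩,
    fun h => d1 ?_, fun h => d2 ?_, fun h => d3 ?_⟩
  all_goals exact ((hg _).trans h).trans (hg _).symm

/-- There are at most as many disjoint trifurcating sets as end-points. -/
theorem card_le_of_trifurcates [DecidableEq V] [DecidableEq ι] (Y : ι → Set V) (J : Finset ι)
    (S : Finset V) (hdisj : ∀ i ∈ J, ∀ j ∈ J, i ≠ j → Disjoint (Y i) (Y j))
    (h : ∀ j ∈ J, Trifurcates G S (Y j)) : J.card ≤ S.card := by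
  classical
  induction hn : J.card generalizing J S with
  | zero => exact Nat.zero_le _
  | succ n ih =>
  -- the number of other sets in the component of `v` after the removal of `Y j`
  let N : ι → V → ℕ := fun j v => (J.filter fun i => i ≠ j ∧
    ∀ y ∈ Y i, (within G (Y j)ᶜ).Reachable v y).card
  -- A pair `(j, v)` maximising `N` plays the role of a leaf: all other sets in the cluster of `Y j`
  -- lie in the branch of `v`. Two further branches contain no other set; their end-points `a` and
  -- `b` are interchangeable for every other set, so `j` and `a` can be deleted together.
  let A : Set ℕ := {m | ∃ j ∈ J, ∃ v ∉ Y j, (∃ y ∈ Y j, G.Reachable v y) ∧ N j v = m}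
  have hA : A.Nonempty := by
    obtain ⟨j, hj⟩ := Finset.card_pos.1 (by omega : 0 < J.card)
    obtain ⟨-, s, -, -, -, -, -, ⟨a, -⟩, ⟨b, -⟩, -⟩ := h j hj
    exact ⟨_, j, hj, s, a, b, rfl⟩
  have hAb : BddAbove A := ⟨J.card, by
    rintro _ ⟨j, -, v, -, -, rfl⟩
    exact Finset.card_filter_le _ _⟩
  obtain ⟨j, hj, v, hv, hvj, hmax⟩ := Nat.sSup_mem hA hAb
  replace hmax : ∀ i ∈ J, ∀ w ∉ Y i, (∃ y ∈ Y i, G.Reachable w y) → N i w ≤ N j v :=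
    fun i hi w h1 h2 => hmax ▸ le_csSup hAb ⟨i, hi, w, h1, h2, rfl⟩
  have hattach : ∀ a, a ∉ Y j → (∃ y ∈ Y j, G.Reachable a y) →
      ∃ u c, c ∈ Y j ∧ G.Adj u c ∧ (within G (Y j)ᶜ).Reachable a u := by
    rintro a ha ⟨y, hy, hay⟩
    obtain ⟨u, c, -, hc, huc, hr⟩ := exists_first_hit hay ha hy
    exact ⟨u, c, hc, huc, hr⟩
  -- if the component of `a` after removal of `Y j` does not meet `Y i`, then it is connected to
  -- `Y j` without using `Y i`
  have hconn : ∀ a, a ∉ Y j → (∃ y ∈ Y j, G.Reachable a y) → ∀ i ∈ J, i ≠ j →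
      (∀ w ∈ Y i, ¬ (within G (Y j)ᶜ).Reachable a w) → ∃ c ∈ Y j,
        ∀ w, (within G (Y j)ᶜ).Reachable a w ∨ w ∈ Y j → (within G (Y i)ᶜ).Reachable c w := by
    intro a ha haj i hi hij hw
    obtain ⟨u, c, hc, huc, hr⟩ := hattach a ha haj
    have hd := hdisj i hi j hj hij
    have hYj : Y j ⊆ (Y i)ᶜ := fun y hy hyi => disjoint_left.1 hd hyi hy
    have hin : ∀ w, (within G (Y j)ᶜ).Reachable a w → (within G (Y i)ᶜ).Reachable a w :=
      fun w haw => by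
        have := reachable_within_of_forall (s := (Y i)ᶜ) haw fun x hx hxi => hw x hxi hx
        rw [within_within] at this
        exact this.mono (within_mono le_rfl inter_subset_right)
    have huc' : (within G (Y i)ᶜ).Adj u c := ⟨huc, fun hu => hw u hu hr, hYj hc⟩
    have hca : (within G (Y i)ᶜ).Reachable c a := ((hin u hr).trans huc'.reachable).symm
    refine ⟨c, hc, fun w hw => ?_⟩
    rcases hw with hw | hw
    · exact hca.trans (hin w hw)
    · exact ((h j hj).connected c hc w hw).mono (within_mono le_rfl hYj)
  have hYc : ∀ i ∈ J, i ≠ j → ∀ x ∈ Y i, ∀ y ∈ Y i, (within G (Y j)ᶜ).Reachable x y :=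
    fun i hi hij x hx y hy => ((h i hi).connected x hx y hy).mono
      (within_mono le_rfl fun z hz hzj => disjoint_left.1 (hdisj i hi j hj hij) hz hzj)
  have hYne : ∀ i ∈ J, (Y i).Nonempty := fun i hi => by
    obtain ⟨-, s, -, -, -, -, -, -, ⟨⟨y, hy, -⟩, -⟩, -⟩ := h i hi
    exact ⟨y, hy⟩
  -- all the other sets in the same cluster are in the component of `v`
  have hleaf : ∀ i ∈ J, i ≠ j → (∃ w ∈ Y i, ∃ y ∈ Y j, G.Reachable y w) →
      ∃ w ∈ Y i, (within G (Y j)ᶜ).Reachable v w := by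
    rintro i hi hij ⟨w, hw, y, hy, hyw⟩
    by_contra! hcon
    obtain ⟨c, hc, hcw⟩ := hconn v hv hvj i hi hij hcon
    have hci : c ∉ Y i := fun hci => disjoint_left.1 (hdisj i hi j hj hij) hci hc
    have hcy : G.Reachable c w :=
      (((h j hj).connected c hc y hy).mono (within_le _ _)).trans hyw
    -- Seen from `Y i`, the component of `c` contains every set counted by `N j v` and `Y j` as
    -- well, which contradicts maximality.
    have hle := hmax i hi c hci ⟨w, hw, hcy⟩
    refine absurd hle (not_le.2 (Finset.card_lt_card ?_))
    refine Finset.ssubset_iff_subset_ne.2 ⟨fun l hl => ?_, fun heq => ?_⟩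
    · simp only [Finset.mem_filter] at hl ⊢
      refine ⟨hl.1, ?_, fun y hy => hcw y (Or.inl (hl.2.2 y hy))⟩
      rintro rfl
      obtain ⟨y, hy⟩ := hYne l hi
      exact hcon y hy (hl.2.2 y hy)
    · have hjm : j ∈ J.filter fun l => l ≠ i ∧ ∀ y ∈ Y l, (within G (Y i)ᶜ).Reachable c y := by
        rw [Finset.mem_filter]
        exact ⟨hj, hij.symm, fun y hy => hcw y (Or.inr hy)⟩
      rw [← heq, Finset.mem_filter] at hjm
      exact hjm.2.1 rfl
  obtain ⟨a, haS, b, hbS, ha, hb, haj, hbj, hab, hav, hbv⟩ : ∃ a ∈ S, ∃ b ∈ S, a ∉ Y j ∧ b ∉ Y j ∧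
      (∃ y ∈ Y j, G.Reachable a y) ∧ (∃ y ∈ Y j, G.Reachable b y) ∧
      ¬ (within G (Y j)ᶜ).Reachable a b ∧ ¬ (within G (Y j)ᶜ).Reachable a v ∧
      ¬ (within G (Y j)ᶜ).Reachable b v := by
    obtain ⟨h0, s₁, h1, s₂, h2, s₃, h3, ⟨a1, a2, a3⟩, ⟨b1, b2, b3⟩, d1, d2, d3⟩ := h j hj
    by_cases e1 : (within G (Y j)ᶜ).Reachable s₁ v
    · exact ⟨s₂, h2, s₃, h3, a2, a3, b2, b3, d3, fun e => d1 (e1.trans e.symm),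
        fun e => d2 (e1.trans e.symm)⟩
    by_cases e2 : (within G (Y j)ᶜ).Reachable s₂ v
    · exact ⟨s₁, h1, s₃, h3, a1, a3, b1, b3, d2, e1, fun e => d3 (e2.trans e.symm)⟩
    · exact ⟨s₁, h1, s₂, h2, a1, a2, b1, b2, d1, e1, e2⟩
  have hfar : ∀ a, a ∉ Y j → (∃ y ∈ Y j, G.Reachable a y) → ¬ (within G (Y j)ᶜ).Reachable a v →
      ∀ i ∈ J, i ≠ j → ∀ w ∈ Y i, ¬ (within G (Y j)ᶜ).Reachable a w := by
    rintro a - ⟨y, hy, hay⟩ hav i hi hij w hw haw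
    obtain ⟨w', hw', hvw'⟩ := hleaf i hi hij ⟨w, hw, y, hy,
      hay.symm.trans (haw.mono (within_le _ _))⟩
    exact hav ((haw.trans (hYc i hi hij w hw w' hw')).trans hvw'.symm)
  -- The branches of `a` and `b` avoid `Y i` and both attach to `Y j`, which is connected and
  -- disjoint from `Y i`.
  have hreach : ∀ i ∈ J, i ≠ j → a ∉ Y i ∧ b ∉ Y i ∧ (within G (Y i)ᶜ).Reachable a b := by
    intro i hi hij
    have fa := hfar a ha haj hav i hi hij
    have fb := hfar b hb hbj hbv i hi hij
    obtain ⟨c, hc, hca⟩ := hconn a ha haj i hi hij fa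
    obtain ⟨c', hc', hcb⟩ := hconn b hb hbj i hi hij fb
    refine ⟨fun h => fa a h .rfl, fun h => fb b h .rfl, ?_⟩
    exact ((hca a (Or.inl .rfl)).symm.trans (hca c' (Or.inr hc'))).trans (hcb b (Or.inl .rfl))
  have hba : b ≠ a := fun h => hab (h ▸ .rfl)
  have := ih (J.erase j) (S.erase a)
    (fun i hi l hl => hdisj i (Finset.mem_of_mem_erase hi) l (Finset.mem_of_mem_erase hl))
    (fun i hi => by
      obtain ⟨hij, hiJ⟩ := Finset.mem_erase.1 hi
      obtain ⟨hai, hbi, hr⟩ := hreach i hiJ hij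
      refine (h i hiJ).replace (fun s => if s = a then b else s) (fun s hs => ?_)
        (fun s hs => ?_) fun s => ?_
      · rw [Finset.coe_erase]
        split_ifs with hsa
        · exact ⟨hbS, hba⟩
        · exact ⟨hs, hsa⟩
      · split_ifs
        exacts [hbi, hs]
      · split_ifs with hsa
        · rw [hsa]; exact hr
        · rfl)
    (by rw [Finset.card_erase_of_mem hj, hn]; rfl)
  rw [Finset.card_erase_of_mem haS] at this
  have := Finset.card_pos.2 ⟨a, haS⟩
  omega

end Count

/-! ### Three ends and trifurcations in finite sets. -/

section Ends

variable {V : Type*}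

/-- Some cluster has three infinite parts after the removal of a finite set. -/
def HasThreeEnds (G : SimpleGraph V) : Prop :=
  ∃ B : Finset V, ∃ s₁ s₂ s₃ : V,
    ({y | (within G (B : Set V)ᶜ).Reachable s₁ y}.Infinite ∧
      {y | (within G (B : Set V)ᶜ).Reachable s₂ y}.Infinite ∧
      {y | (within G (B : Set V)ᶜ).Reachable s₃ y}.Infinite) ∧
    (G.Reachable s₁ s₂ ∧ G.Reachable s₁ s₃) ∧
    ¬ (within G (B : Set V)ᶜ).Reachable s₁ s₂ ∧ ¬ (within G (B : Set V)ᶜ).Reachable s₁ s₃ ∧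
    ¬ (within G (B : Set V)ᶜ).Reachable s₂ s₃

/-- The removal of some finite connected subset of `D` leaves three infinite parts of its cluster. -/
def HasTrifurcationIn (G : SimpleGraph V) (D : Set V) : Prop :=
  ∃ Y : Finset V, (Y : Set V) ⊆ D ∧ (∀ a ∈ Y, ∀ b ∈ Y, (within G (Y : Set V)).Reachable a b) ∧
    ∃ s₁ s₂ s₃ : V,
    ({y | (within G (Y : Set V)ᶜ).Reachable s₁ y}.Infinite ∧
      {y | (within G (Y : Set V)ᶜ).Reachable s₂ y}.Infinite ∧
      {y | (within G (Y : Set V)ᶜ).Reachable s₃ y}.Infinite) ∧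
    ((∃ y ∈ Y, G.Reachable s₁ y) ∧ (∃ y ∈ Y, G.Reachable s₂ y) ∧ ∃ y ∈ Y, G.Reachable s₃ y) ∧
    ¬ (within G (Y : Set V)ᶜ).Reachable s₁ s₂ ∧ ¬ (within G (Y : Set V)ᶜ).Reachable s₁ s₃ ∧
    ¬ (within G (Y : Set V)ᶜ).Reachable s₂ s₃

theorem exists_connected_finset [DecidableEq V] {G : SimpleGraph V} (s : V) (A : Finset V)
    (hA : ∀ a ∈ A, G.Reachable s a) : ∃ Y : Finset V, s ∈ Y ∧ A ⊆ Y ∧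
      ∀ a ∈ Y, (within G (Y : Set V)).Reachable s a := by
  induction A using Finset.induction_on with
  | empty => exact ⟨{s}, by simp, by simp, by simp⟩
  | insert a A ha ih =>
    obtain ⟨Y, hs, hAY, hY⟩ := ih fun b hb => hA b (Finset.mem_insert_of_mem hb)
    obtain ⟨p⟩ := hA a (Finset.mem_insert_self a A)
    refine ⟨Y ∪ p.support.toFinset, Finset.mem_union_left _ hs, ?_, fun b hb => ?_⟩
    · refine Finset.insert_subset ?_ (hAY.trans Finset.subset_union_left)
      exact Finset.mem_union_right _ (by simp)
    · rcases Finset.mem_union.1 hb with hb | hb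
      · exact (hY b hb).mono (within_mono le_rfl (by simp))
      · rw [List.mem_toFinset] at hb
        have key : ∀ {u v : V} (q : G.Walk u v) (T : Set V), (∀ x ∈ q.support, x ∈ T) →
            (within G T).Reachable u v := by
          intro u v q T hq
          induction q with
          | nil => rfl
          | @cons u v w h q ih =>
            have h' : (within G T).Adj u v := ⟨h, hq _ (by simp), hq _ (by simp)⟩
            exact h'.reachable.trans (ih fun x hx => hq x (by simp [hx]))
        refine key (p.takeUntil b hb) _ fun x hx => ?_
        have := p.support_takeUntil_subset_support hb hx
        simp [this]

/-- Join the points of `B` in the relevant cluster to `s₁` by walks to get a connected `Y`. Each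
infinite part off `B` keeps an infinite part off `Y`. These stay separated, because `Y` contains
every point of `B` that the cluster could use. -/
theorem HasThreeEnds.exists_trifurcation {G : SimpleGraph V} (hG : ∀ v, (G.neighborSet v).Finite)
    (h : HasThreeEnds G) : ∃ Y : Finset V, HasTrifurcationIn G (Y : Set V) := by
  classical
  obtain ⟨B, s₁, s₂, s₃, ⟨i1, i2, i3⟩, ⟨r2, r3⟩, d1, d2, d3⟩ := h
  obtain ⟨Y, hs, hBY, hY⟩ := exists_connected_finset (G := G) s₁ (B.filter (G.Reachable s₁))
    fun a ha => (Finset.mem_filter.1 ha).2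
  have hfin : ∀ v, ((within G (B : Set V)ᶜ).neighborSet v).Finite := fun v =>
    (hG v).subset fun w hw => hw.1
  have key : ∀ s, G.Reachable s₁ s → {y | (within G (B : Set V)ᶜ).Reachable s y}.Infinite →
      ∃ s', (within G (B : Set V)ᶜ).Reachable s s' ∧
        {y | (within G (Y : Set V)ᶜ).Reachable s' y}.Infinite := by
    intro s _ hs
    obtain ⟨u, -, hu, hinf, -⟩ := exists_infinite_within_compl hfin Y.finite_toSet hs
    refine ⟨u, hu, hinf.mono fun y hy => ?_⟩
    rw [mem_ofPred_eq, within_within] at hy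
    exact hy.mono (within_mono le_rfl inter_subset_right)
  obtain ⟨t₁, u1, j1⟩ := key s₁ .rfl i1
  obtain ⟨t₂, u2, j2⟩ := key s₂ r2 i2
  obtain ⟨t₃, u3, j3⟩ := key s₃ r3 i3
  have hback : ∀ a b, G.Reachable s₁ a → (within G (Y : Set V)ᶜ).Reachable a b →
      (within G (B : Set V)ᶜ).Reachable a b ∨ a ∈ Y := by
    intro a b ha hab
    by_cases haY : a ∈ Y
    · exact Or.inr haY
    refine Or.inl ?_
    have := reachable_within_of_forall (s := (B : Set V)ᶜ) hab fun w hw hwB => by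
      have hwY := mem_of_reachable_within hw haY
      refine hwY (hBY (Finset.mem_filter.2 ⟨hwB, ?_⟩))
      exact ha.trans (hw.mono (within_le _ _))
    rw [within_within] at this
    exact this.mono (within_mono le_rfl inter_subset_right)
  have hmemY : ∀ t, {y | (within G (Y : Set V)ᶜ).Reachable t y}.Infinite → t ∉ Y := by
    intro t ht htY
    refine ht ((finite_singleton t).subset ?_)
    rintro y ⟨p⟩
    cases p with
    | nil => rfl
    | cons h p => exact absurd htY h.2.1
  have hcl : ∀ {s t}, (within G (B : Set V)ᶜ).Reachable s t → G.Reachable s t :=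
    fun h => h.mono (within_le _ _)
  have q1 := hcl u1
  have q2 := r2.trans (hcl u2)
  have q3 := r3.trans (hcl u3)
  refine ⟨Y, Y, subset_rfl, fun a ha b hb => (hY a ha).symm.trans (hY b hb), t₁, t₂, t₃,
    ⟨j1, j2, j3⟩, ⟨⟨s₁, hs, q1.symm⟩, ⟨s₁, hs, q2.symm⟩, s₁, hs, q3.symm⟩, fun h => ?_, fun h => ?_,
    fun h => ?_⟩
  · have := (hback _ _ q1 h).resolve_right (hmemY _ j1)
    exact d1 ((u1.trans this).trans u2.symm)
  · have := (hback _ _ q1 h).resolve_right (hmemY _ j1)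
    exact d2 ((u1.trans this).trans u3.symm)
  · have := (hback _ _ q2 h).resolve_right (hmemY _ j2)
    exact d3 ((u2.trans this).trans u3.symm)

theorem HasTrifurcationIn.mono {G : SimpleGraph V} {D D' : Set V} (h : HasTrifurcationIn G D)
    (hD : D ⊆ D') : HasTrifurcationIn G D' := by
  obtain ⟨Y, hY, h⟩ := h
  exact ⟨Y, hY.trans hD, h⟩

/-- Graph isomorphisms restrict to subsets. -/
def withinIso {V' : Type*} {G : SimpleGraph V} {G' : SimpleGraph V'} (φ : G ≃g G') (s : Set V) :
    within G s ≃g within G' (φ '' s) where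
  toEquiv := φ.toEquiv
  map_rel_iff' {a b} := by
    refine and_congr φ.map_rel_iff (and_congr ?_ ?_)
    · exact φ.injective.mem_set_image
    · exact φ.injective.mem_set_image

theorem HasTrifurcationIn.map {V' : Type*} [DecidableEq V'] {G : SimpleGraph V}
    {G' : SimpleGraph V'} (φ : G ≃g G') {D : Set V} (h : HasTrifurcationIn G D) :
    HasTrifurcationIn G' (φ '' D) := by
  obtain ⟨Y, hY, hc, s₁, s₂, s₃, ⟨i1, i2, i3⟩, ⟨⟨y1, b1, c1⟩, ⟨y2, b2, c2⟩, y3, b3, c3⟩,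
    d1, d2, d3⟩ := h
  have hcoe : ((Y.image φ : Finset V') : Set V') = φ '' Y := Finset.coe_image
  have hcompl : ((Y.image φ : Finset V') : Set V')ᶜ = φ '' (Y : Set V)ᶜ := by
    rw [hcoe, image_compl_eq φ.bijective]
  have hr : ∀ x y, (within G' ((Y.image φ : Finset V') : Set V')ᶜ).Reachable (φ x) (φ y) ↔
      (within G (Y : Set V)ᶜ).Reachable x y := fun x y => by
    rw [hcompl]
    exact (withinIso φ (Y : Set V)ᶜ).reachable_iff
  have hinf : ∀ x, {y | (within G (Y : Set V)ᶜ).Reachable x y}.Infinite →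
      {y | (within G' ((Y.image φ : Finset V') : Set V')ᶜ).Reachable (φ x) y}.Infinite := by
    intro x hx
    refine (hx.image φ.injective.injOn).mono ?_
    rintro _ ⟨y, hy, rfl⟩
    exact (hr x y).2 hy
  refine ⟨Y.image φ, ?_, ?_, φ s₁, φ s₂, φ s₃, ⟨hinf _ i1, hinf _ i2, hinf _ i3⟩,
    ⟨⟨φ y1, Finset.mem_image_of_mem _ b1, φ.reachable_iff.2 c1⟩,
      ⟨φ y2, Finset.mem_image_of_mem _ b2, φ.reachable_iff.2 c2⟩,
      φ y3, Finset.mem_image_of_mem _ b3, φ.reachable_iff.2 c3⟩,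
    by rwa [hr], by rwa [hr], by rwa [hr]⟩
  · rw [hcoe]; exact image_mono hY
  · intro a ha b hb
    obtain ⟨a, ha', rfl⟩ := Finset.mem_image.1 ha
    obtain ⟨b, hb', rfl⟩ := Finset.mem_image.1 hb
    rw [hcoe]
    exact (withinIso φ (Y : Set V)).reachable_iff.2 (hc a ha' b hb')

end Ends

/-! ### The Burton–Keane argument. -/

section Probability

variable {d : ℕ}

theorem neighborSet_finite_of_le_lattice {G : SimpleGraph (Fin d → ℤ)} (hG : G ≤ lattice d)
    (v : Fin d → ℤ) : (G.neighborSet v).Finite :=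
  (lattice_neighborSet_finite v).subset fun _ hw => hG hw

theorem nullMeasurableSet_within_adj {k : ℕ} (hk : 1 ≤ k) (t : unitInterval)
    (s : Set (Fin d → ℤ)) (v w : Fin d → ℤ) :
    NullMeasurableSet {U : Clocks d | (within (openGraph k U t) s).Adj v w} (clockMeasure d) :=
  (nullMeasurableSet_adj hk t v w).inter (NullMeasurableSet.const _)

theorem nullMeasurableSet_hasTrifurcationIn {k : ℕ} (hk : 1 ≤ k) (t : unitInterval)
    (D : Set (Fin d → ℤ)) :
    NullMeasurableSet {U : Clocks d | HasTrifurcationIn (openGraph k U t) D} (clockMeasure d) := by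
  have hr := fun s => nullMeasurableSet_reachable (nullMeasurableSet_within_adj (d := d) hk t s)
  have hi := fun s => nullMeasurableSet_infinite (nullMeasurableSet_within_adj (d := d) hk t s)
  have hg := nullMeasurableSet_reachable (nullMeasurableSet_adj (d := d) hk t)
  simp only [HasTrifurcationIn, ofPred_exists, ofPred_and, ofPred_forall]
  refine .iUnion fun Y => .inter (.const _) (.inter (.iInter fun a => .iInter fun _ => .iInter
    fun b => .iInter fun _ => hr _ _ _) (.iUnion fun s₁ => .iUnion fun s₂ => .iUnion fun s₃ =>
    .inter (.inter (hi _ _) (.inter (hi _ _) (hi _ _))) (.inter (.inter ?_ (.inter ?_ ?_))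
    (.inter (hr _ _ _).compl (.inter (hr _ _ _).compl (hr _ _ _).compl)))))
  all_goals exact .iUnion fun y => .inter (.const _) (hg _ _)

/-- The component reaches a neighbour of `Y`. Either that neighbour is already outside the box, in
the adjacent layer, or the infinite component must leave the box through this layer. End-points can
thus be taken in a set of surface order. -/
theorem exists_sphere_of_infinite {G : SimpleGraph (Fin d → ℤ)} (hG : G ≤ lattice d)
    {a b : Fin d → ℤ} {Y : Set (Fin d → ℤ)} (hY : Y ⊆ Icc a b) {s : Fin d → ℤ}
    (hs : {y | (within G Yᶜ).Reachable s y}.Infinite) (hsY : ∃ y ∈ Y, G.Reachable s y) :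
    s ∉ Y ∧ ∃ s', s' ∈ Icc (a - 1) (b + 1) ∧ s' ∉ Icc a b ∧ (within G Yᶜ).Reachable s s' := by
  have hsn : s ∉ Y := fun h => hs <| (finite_singleton s).subset <| by
    rintro y ⟨p⟩
    cases p with
    | nil => rfl
    | cons h' p => exact absurd h h'.2.1
  have hstep : ∀ u v, u ∈ Icc a b → (lattice d).Adj u v → v ∈ Icc (a - 1) (b + 1) := by
    intro u v hu huv
    have := Finset.mem_Icc.1 (lattice_adj_mem_Icc huv)
    exact ⟨(sub_le_sub_right hu.1 1).trans this.1, this.2.trans (add_le_add_left hu.2 1)⟩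
  refine ⟨hsn, ?_⟩
  obtain ⟨y, hy, hsy⟩ := hsY
  obtain ⟨u, c, hu, hc, huc, hr⟩ := exists_first_hit hsy hsn hy
  by_cases hub : u ∈ Icc a b
  · obtain ⟨w, hw, hwb⟩ := hs.exists_notMem_finset (Finset.Icc a b)
    rw [← Finset.mem_coe, Finset.coe_Icc] at hwb
    obtain ⟨u', c', hu', hc', huc', hr'⟩ := exists_first_hit (s := (Icc a b)ᶜ)
      (hr.symm.trans hw) (by simpa using hub) hwb
    exact ⟨c', hstep u' c' (not_notMem.1 hu') (hG huc'.1), hc',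
      hr.trans ((hr'.mono (within_le _ _)).trans huc'.reachable)⟩
  · exact ⟨u, hstep c u (hY hc) (hG huc).symm, hub, hr⟩

theorem sum_measure_le_of_card_le {Ω ι : Type*} [MeasurableSpace Ω] (μ : Measure Ω)
    [IsProbabilityMeasure μ] (J : Finset ι) (E : ι → Set Ω) (hE : ∀ j, NullMeasurableSet (E j) μ)
    (c : ℕ) (hc : ∀ ω, ∀ J' ⊆ J, (∀ j ∈ J', ω ∈ E j) → J'.card ≤ c) : ∑ j ∈ J, μ (E j) ≤ c := by
  classical
  calc ∑ j ∈ J, μ (E j) = ∑ j ∈ J, ∫⁻ ω, (E j).indicator 1 ω ∂μ := by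
        simp_rw [lintegral_indicator_one₀ (hE _)]
    _ = ∫⁻ ω, ∑ j ∈ J, (E j).indicator 1 ω ∂μ := by
        exact (lintegral_finsetSum' _ fun j _ =>
          measurable_one.aemeasurable.indicator₀ (hE j)).symm
    _ ≤ ∫⁻ _, c ∂μ := by
        refine lintegral_mono fun ω => ?_
        simp only [indicator_apply, Pi.one_apply, Finset.sum_boole]
        exact_mod_cast hc ω _ (Finset.filter_subset _ J) fun j hj => (Finset.mem_filter.1 hj).2
    _ = c := by simp

theorem card_Icc_pi (a b : ℤ) (h : a ≤ b + 1) :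
    ((Finset.Icc (fun _ => a) (fun _ => b) : Finset (Fin d → ℤ)).card : ℝ) = (b + 1 - a) ^ d := by
  rw [Pi.card_Icc]
  simp only [Int.card_Icc, Finset.prod_const, Finset.card_univ, Fintype.card_fin, Nat.cast_pow]
  have : ((b + 1 - a).toNat : ℤ) = b + 1 - a := Int.toNat_of_nonneg (by omega)
  congr 1
  exact_mod_cast this

/-- The box of radius `n` around the origin. -/
noncomputable def box (d n : ℕ) : Finset (Fin d → ℤ) := Finset.Icc (fun _ => -(n : ℤ)) fun _ => n

theorem mem_box {n : ℕ} {v : Fin d → ℤ} : v ∈ box d n ↔ ∀ i, -(n : ℤ) ≤ v i ∧ v i ≤ n := by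
  simp [box, Pi.le_def, forall_and]

theorem exists_subset_box (Y : Finset (Fin d → ℤ)) : ∃ n, ∀ m ≥ n, Y ⊆ box d m := by
  refine ⟨Y.sup fun v => Finset.univ.sup fun i => (v i).natAbs, fun m hm v hv => ?_⟩
  refine mem_box.2 fun i => ?_
  have := (Finset.le_sup (f := fun i => (v i).natAbs) (Finset.mem_univ i)).trans
    (Finset.le_sup (f := fun v => Finset.univ.sup fun i => (v i).natAbs) hv)
  omega

/-- Volume against surface: `M ^ d` disjoint translates of the box tile a cube of side `w * M`, and
each contains a trifurcation with probability at least `p`. In every configuration at most as many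
of them do as there are sites in the layer around the cube, which is `o(M ^ d)`. -/
theorem measure_hasTrifurcationIn_box {k : ℕ} (hk : 1 ≤ k) (t : unitInterval) (n : ℕ) :
    clockMeasure d {U | HasTrifurcationIn (openGraph k U t) (Icc (fun _ => -(n : ℤ)) fun _ => n)}
      = 0 := by
  classical
  set μ := clockMeasure d
  set p := μ.real {U | HasTrifurcationIn (openGraph k U t) (Icc (fun _ => -(n : ℤ)) fun _ => n)}
    with hp
  set w : ℤ := 2 * n + 1 with hw
  have key : ∀ M : ℕ, 1 ≤ M → (M : ℝ) ^ d * p ≤ ((w : ℝ) * M + 2) ^ d - (w * M) ^ d := by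
    intro M hM
    -- A box of radius `n` has `w = 2n + 1` sites on each side; with these centres the translates
    -- fill the cube `[0, w * M - 1]^d`.
    let x : (Fin d → Fin M) → Fin d → ℤ := fun j i => n + w * (j i : ℕ)
    let E : (Fin d → Fin M) → Set (Clocks d) := fun j => {U | HasTrifurcationIn (openGraph k U t)
      ((· + x j) '' Icc (fun _ => -(n : ℤ)) fun _ => n)}
    let a : Fin d → ℤ := fun _ => 0
    let b : Fin d → ℤ := fun _ => w * M - 1
    have hbox : ∀ j, ((· + x j) '' Icc (fun _ => -(n : ℤ)) fun _ => n) ⊆ Icc a b := by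
      rintro j _ ⟨v, hv, rfl⟩
      have hji : ∀ i, ((j i : ℕ) : ℤ) + 1 ≤ M := fun i => by exact_mod_cast (j i).2
      constructor <;> intro i
      · have h1 : -(n : ℤ) ≤ v i := hv.1 i
        change (0 : ℤ) ≤ v i + (n + w * (j i : ℕ))
        have : 0 ≤ w * (j i : ℕ) := by positivity
        omega
      · have h1 : v i ≤ (n : ℤ) := hv.2 i
        change v i + (n + w * (j i : ℕ)) ≤ w * M - 1
        have : w * (j i : ℕ) + w ≤ w * M := by
          have := mul_le_mul_of_nonneg_left (hji i) (show 0 ≤ w by omega)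
          linarith
        omega
    have hdisj : ∀ j j', j ≠ j' → Disjoint ((· + x j) '' Icc (fun _ => -(n : ℤ)) fun _ => n)
        ((· + x j') '' Icc (fun _ => -(n : ℤ)) fun _ => n) := by
      intro j j' hjj
      rw [Set.disjoint_left]
      rintro _ ⟨v, hv, rfl⟩ ⟨v', hv', h⟩
      refine hjj (funext fun i => Fin.ext ?_)
      have h1 : -(n : ℤ) ≤ v i := hv.1 i
      have h2 : v i ≤ (n : ℤ) := hv.2 i
      have h3 : -(n : ℤ) ≤ v' i := hv'.1 i
      have h4 : v' i ≤ (n : ℤ) := hv'.2 i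
      have h5 : v' i + (n + w * (j' i : ℕ)) = v i + (n + w * (j i : ℕ)) := congrFun h i
      have h6 : w * ((j i : ℕ) - (j' i : ℕ) : ℤ) = v' i - v i := by linarith
      have h7 : |w * ((j i : ℕ) - (j' i : ℕ) : ℤ)| < w := by
        rw [h6, abs_lt]; omega
      rw [abs_mul, abs_of_pos (show 0 < w by omega)] at h7
      have h8 : |((j i : ℕ) - (j' i : ℕ) : ℤ)| < 1 := by
        by_contra! hcon
        nlinarith
      have := Int.abs_lt_one_iff.1 h8
      omega
    have hE : ∀ j, p ≤ μ.real (E j) := by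
      intro j
      rw [hp, ← (measurePreserving_shift (x j)).measureReal_preimage
        (nullMeasurableSet_hasTrifurcationIn hk t _)]
      refine measureReal_mono fun U hU => ?_
      exact HasTrifurcationIn.map (shiftIso k U t (x j)) hU
    let S : Finset (Fin d → ℤ) := Finset.Icc (a - 1) (b + 1) \ Finset.Icc a b
    have hcount := sum_measure_le_of_card_le μ Finset.univ E
      (fun j => nullMeasurableSet_hasTrifurcationIn hk t _) S.card (by
        intro U J' _ hJ'
        choose! Y hY hc s₁ s₂ s₃ hinf hat hsep using hJ'
        refine card_le_of_trifurcates (G := openGraph k U t) (fun j => (Y j : Set (Fin d → ℤ))) J' S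
          (fun i hi j hj hij => (hdisj i j hij).mono (hY i hi) (hY j hj)) fun j hj => ⟨hc j hj, ?_⟩
        have hYb := (hY j hj).trans (hbox j)
        obtain ⟨i1, i2, i3⟩ := hinf j hj
        obtain ⟨a1, a2, a3⟩ := hat j hj
        obtain ⟨d1, d2, d3⟩ := hsep j hj
        have hbase : ∀ s s', s ∉ Y j →
            (within (openGraph k U t) (Y j : Set (Fin d → ℤ))ᶜ).Reachable s s' →
            (∃ y ∈ Y j, (openGraph k U t).Reachable s y) →
            s' ∉ Y j ∧ ∃ y ∈ Y j, (openGraph k U t).Reachable s' y := by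
          rintro s s' hs hr ⟨y, hy, h⟩
          exact ⟨mem_of_reachable_within hr hs, y, hy, (hr.mono (within_le _ _)).symm.trans h⟩
        obtain ⟨n1, t₁, m1, o1, r1⟩ := exists_sphere_of_infinite openGraph_le hYb i1 a1
        obtain ⟨n2, t₂, m2, o2, r2⟩ := exists_sphere_of_infinite openGraph_le hYb i2 a2
        obtain ⟨n3, t₃, m3, o3, r3⟩ := exists_sphere_of_infinite openGraph_le hYb i3 a3
        have hS : ∀ s, s ∈ Icc (a - 1) (b + 1) → s ∉ Icc a b → s ∈ (S : Set (Fin d → ℤ)) := by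
          intro s h1 h2
          simp only [S, Finset.coe_sdiff, Finset.coe_Icc]
          exact ⟨h1, h2⟩
        obtain ⟨p1, q1⟩ := hbase _ _ n1 r1 a1
        obtain ⟨p2, q2⟩ := hbase _ _ n2 r2 a2
        obtain ⟨p3, q3⟩ := hbase _ _ n3 r3 a3
        exact ⟨t₁, hS _ m1 o1, t₂, hS _ m2 o2, t₃, hS _ m3 o3, ⟨p1, p2, p3⟩, ⟨q1, q2, q3⟩,
          fun h => d1 ((r1.trans h).trans r2.symm), fun h => d2 ((r1.trans h).trans r3.symm),
          fun h => d3 ((r2.trans h).trans r3.symm)⟩)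
    have hsum : (M : ℝ) ^ d * p ≤ S.card := by
      have h1 : (∑ j, μ (E j)).toReal ≤ S.card := by
        have := ENNReal.toReal_mono (by simp) hcount
        simpa using this
      rw [ENNReal.toReal_sum (by finiteness)] at h1
      refine le_trans ?_ h1
      have h2 := Finset.sum_le_sum fun j (_ : j ∈ Finset.univ) => hE j
      rw [Finset.sum_const, Finset.card_univ] at h2
      simpa [measureReal_def] using h2
    refine hsum.trans (le_of_eq ?_)
    have hsub : Finset.Icc a b ⊆ Finset.Icc (a - 1) (b + 1) :=
      Finset.Icc_subset_Icc (by simp) (by simp)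
    rw [Finset.card_sdiff_of_subset hsub, Nat.cast_sub (Finset.card_le_card hsub)]
    have hwM : 0 ≤ w * M := by positivity
    have e1 : ((Finset.Icc a b).card : ℝ) = _ := card_Icc_pi 0 (w * M - 1) (by omega)
    have e2 : ((Finset.Icc (a - 1) (b + 1)).card : ℝ) = _ :=
      card_Icc_pi (0 - 1) (w * M - 1 + 1) (by omega)
    rw [e1, e2]
    push_cast
    congr 2 <;> ring
  have hlim : Filter.Tendsto (fun M : ℕ => ((w : ℝ) + 2 / M) ^ d - (w : ℝ) ^ d) Filter.atTop
      (nhds ((w + 0) ^ d - (w : ℝ) ^ d)) := by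
    refine ((tendsto_const_nhds.add ?_).pow d).sub_const _
    exact tendsto_const_div_atTop_nhds_zero_nat 2
  have hle : p ≤ 0 := by
    rw [add_zero, sub_self] at hlim
    refine ge_of_tendsto hlim ?_
    filter_upwards [Filter.eventually_ge_atTop 1] with M hM
    have hM0 : (0 : ℝ) < M := by exact_mod_cast hM
    have hkey := key M hM
    have h1 : ((w : ℝ) * M + 2) ^ d = (M : ℝ) ^ d * (w + 2 / M) ^ d := by
      rw [← mul_pow]; congr 1; field_simp
    rw [h1, mul_pow (w : ℝ), mul_comm ((w : ℝ) ^ d), ← mul_sub] at hkey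
    exact le_of_mul_le_mul_left hkey (by positivity)
  have := le_antisymm hle measureReal_nonneg
  exact (measureReal_eq_zero_iff (by finiteness)).1 this

/-- Almost surely, no open cluster has three ends. -/
theorem measure_hasThreeEnds {k : ℕ} (hk : 1 ≤ k) (t : unitInterval) :
    clockMeasure d {U | HasThreeEnds (openGraph k U t)} = 0 := by
  refine measure_mono_null ?_ (measure_iUnion_null fun n => measure_hasTrifurcationIn_box hk t n)
  intro U hU
  obtain ⟨Y, hY⟩ := HasThreeEnds.exists_trifurcation
    (neighborSet_finite_of_le_lattice openGraph_le) hU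
  obtain ⟨n, hn⟩ := exists_subset_box Y
  exact mem_iUnion.2 ⟨n, hY.mono fun v hv => by simpa [box] using hn n le_rfl hv⟩

end Probability

end CDP

/-! ### Uniqueness of the infinite cluster for constraint at least three. -/

namespace CDP

variable {d : ℕ}

/-- There are two distinct infinite clusters. -/
def NonUnique {V : Type*} (G : SimpleGraph V) : Prop :=
  ∃ x y, {z | G.Reachable x z}.Infinite ∧ {z | G.Reachable y z}.Infinite ∧ ¬ G.Reachable x y

theorem nullMeasurableSet_cluster_infinite {k : ℕ} (hk : 1 ≤ k) (t : unitInterval)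
    (x : Fin d → ℤ) :
    NullMeasurableSet {U : Clocks d | (cluster k U t x).Infinite} (clockMeasure d) :=
  nullMeasurableSet_infinite (nullMeasurableSet_adj hk t) x

theorem nullMeasurableSet_nonUnique {k : ℕ} (hk : 1 ≤ k) (t : unitInterval) :
    NullMeasurableSet {U : Clocks d | NonUnique (openGraph k U t)} (clockMeasure d) := by
  simp only [NonUnique, ofPred_exists, ofPred_and]
  exact .iUnion fun x => .iUnion fun y => .inter (nullMeasurableSet_cluster_infinite hk t x)
    (.inter (nullMeasurableSet_cluster_infinite hk t y)
      (nullMeasurableSet_reachable (nullMeasurableSet_adj hk t) x y).compl)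

theorem nonUnique_shift {k : ℕ} {U : Clocks d} {t : unitInterval} (x : Fin d → ℤ) :
    NonUnique (openGraph k (shift x U) t) ↔ NonUnique (openGraph k U t) := by
  constructor
  · rintro ⟨a, b, ha, hb, hab⟩
    exact ⟨a + x, b + x, cluster_shift_infinite.1 ha, cluster_shift_infinite.1 hb,
      fun h => hab (openGraph_shift_reachable.2 h)⟩
  · rintro ⟨a, b, ha, hb, hab⟩
    refine ⟨a - x, b - x, cluster_shift_infinite.2 ?_, cluster_shift_infinite.2 ?_, fun h => hab ?_⟩
    · rwa [sub_add_cancel]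
    · rwa [sub_add_cancel]
    · simpa using openGraph_shift_reachable.1 h

/-- The site `u` lies outside `D`, is adjacent to `D`, and is in an infinite cluster outside `D`. -/
structure Attached (G : SimpleGraph (Fin d → ℤ)) (D : Finset (Fin d → ℤ)) (u : Fin d → ℤ) :
    Prop where
  notMem : u ∉ D
  infinite : {y | (within G (D : Set (Fin d → ℤ))ᶜ).Reachable u y}.Infinite
  exists_adj : ∃ z ∈ D, G.Adj u z

theorem exists_attached {G : SimpleGraph (Fin d → ℤ)} (hG : G ≤ lattice d)
    {D : Finset (Fin d → ℤ)} {x : Fin d → ℤ} (hxD : x ∈ D)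
    (hx : {y | G.Reachable x y}.Infinite) : ∃ u, Attached G D u ∧ G.Reachable x u := by
  obtain ⟨u, huD, hxu, hinf, h⟩ := exists_infinite_within_compl
    (neighborSet_finite_of_le_lattice hG) D.finite_toSet hx
  refine ⟨u, ⟨huD, hinf, h.resolve_left ?_⟩, hxu⟩
  rintro rfl
  exact huD hxD

theorem patch_reachable {G : SimpleGraph (Fin d → ℤ)} (hG : G ≤ lattice d) {n : ℕ}
    {u u' : Fin d → ℤ} (hu : ∃ z ∈ box d n, G.Adj u z) (hu' : ∃ z ∈ box d n, G.Adj u' z) :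
    (patch G (box d n)).Reachable u u' := by
  have hadj : ∀ {u z}, z ∈ box d n → G.Adj u z → (patch G (box d n)).Reachable u z :=
    fun hz h => SimpleGraph.Adj.reachable ⟨hG h, Or.inr ⟨h, Or.inr hz⟩⟩
  obtain ⟨z, hz, h⟩ := hu
  obtain ⟨z', hz', h'⟩ := hu'
  refine (hadj hz h).trans (.trans ?_ (hadj hz' h').symm)
  rw [box, ← Finset.mem_coe, Finset.coe_Icc] at hz hz'
  have hle : within (lattice d) (Icc (fun _ => -(n : ℤ)) fun _ => n) ≤ patch G (box d n) := by
    refine fun a b hab => ⟨hab.1, Or.inl ⟨?_, ?_⟩⟩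
    · rw [box, ← Finset.mem_coe, Finset.coe_Icc]; exact hab.2.1
    · rw [box, ← Finset.mem_coe, Finset.coe_Icc]; exact hab.2.2
  exact (box_reachable hz hz').mono hle

theorem Rewired.within_compl_le {k : ℕ} {G H G' : SimpleGraph (Fin d → ℤ)}
    {D : Finset (Fin d → ℤ)} (h : Rewired k G H G' D) :
    within G (D : Set (Fin d → ℤ))ᶜ ≤ G' :=
  fun _ _ hxy => h.adj_of_notMem _ _ hxy.2.1 hxy.2.2 hxy.1

theorem Rewired.within_nbhd_compl {k : ℕ} {G H G' : SimpleGraph (Fin d → ℤ)}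
    {D : Finset (Fin d → ℤ)} (h : Rewired k G H G' D) :
    within G' (nbhd D)ᶜ = within G (nbhd D)ᶜ := by
  ext x y
  exact and_congr_left fun hxy => h.adj_iff x y hxy.1 hxy.2

/-- The set to remove is `nbhd D`, not `D`: a rewiring may open new edges at sites adjacent to `D`,
but off `nbhd D` both graphs agree. Hence the parts stay separated as in `G`, while `H` joins them
in `G'`. -/
theorem Rewired.hasThreeEnds {k : ℕ} {G H G' : SimpleGraph (Fin d → ℤ)} (hG : G ≤ lattice d)
    {D : Finset (Fin d → ℤ)} (h : Rewired k G H G' D) {u₁ u₂ u₃ : Fin d → ℤ}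
    (h1 : Attached G D u₁) (h2 : Attached G D u₂) (h3 : Attached G D u₃)
    (h12 : ¬ (within G (D : Set (Fin d → ℤ))ᶜ).Reachable u₁ u₂)
    (h13 : ¬ (within G (D : Set (Fin d → ℤ))ᶜ).Reachable u₁ u₃)
    (h23 : ¬ (within G (D : Set (Fin d → ℤ))ᶜ).Reachable u₂ u₃)
    (hr2 : H.Reachable u₁ u₂) (hr3 : H.Reachable u₃ u₁) : HasThreeEnds G' := by
  have key : ∀ u, Attached G D u → ∃ s, (within G (D : Set (Fin d → ℤ))ᶜ).Reachable u s ∧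
      {y | (within G (nbhd D)ᶜ).Reachable s y}.Infinite := by
    intro u hu
    obtain ⟨s, -, hus, hinf, -⟩ := exists_infinite_within_compl
      (G := within G (D : Set (Fin d → ℤ))ᶜ)
      (fun v => (neighborSet_finite_of_le_lattice hG v).subset fun w hw => hw.1)
      (nbhd_finite D) hu.infinite
    refine ⟨s, hus, hinf.mono fun y hy => ?_⟩
    rw [mem_ofPred_eq, within_within] at hy
    exact hy.mono (within_mono le_rfl inter_subset_right)
  obtain ⟨s₁, r1, i1⟩ := key u₁ h1
  obtain ⟨s₂, r2, i2⟩ := key u₂ h2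
  obtain ⟨s₃, r3, i3⟩ := key u₃ h3
  have hle : within G (nbhd D)ᶜ ≤ within G (D : Set (Fin d → ℤ))ᶜ :=
    within_mono le_rfl (compl_subset_compl.2 (subset_nbhd D))
  have hle' := h.within_compl_le
  refine ⟨(nbhd_finite D).toFinset, s₁, s₂, s₃, ?_⟩
  rw [Finite.coe_toFinset, h.within_nbhd_compl]
  refine ⟨⟨i1, i2, i3⟩, ⟨?_, ?_⟩, fun h => h12 ?_, fun h => h13 ?_, fun h => h23 ?_⟩
  · exact ((r1.mono hle').symm.trans (hr2.mono h.le)).trans (r2.mono hle')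
  · exact ((r1.mono hle').symm.trans (hr3.symm.mono h.le)).trans (r3.mono hle')
  · exact (r1.trans (h.mono hle)).trans r2.symm
  · exact (r1.trans (h.mono hle)).trans r3.symm
  · exact (r2.trans (h.mono hle)).trans r3.symm

/-- If there are two infinite clusters, then after a suitable rewiring there is a cluster with three
ends or a unique infinite cluster. -/
theorem NonUnique.exists_rewiring {k : ℕ} (hk : 3 ≤ k) {G : SimpleGraph (Fin d → ℤ)}
    (hG : G ≤ lattice d) (h : NonUnique G) :
    ∃ (D : Finset (Fin d → ℤ)) (H : SimpleGraph (Fin d → ℤ)), H ≤ patch G D ∧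
      (∀ v ∈ D, (H.neighborSet v).encard ≤ k) ∧
      ∀ G', Rewired k G H G' D → HasThreeEnds G' ∨ ¬ NonUnique G' := by
  -- Either some box sees three infinite parts, which a tree of degree three turns into one cluster
  -- with three ends, or every box sees at most two. In the latter case `G` has exactly two infinite
  -- clusters, and a path merges them.
  by_cases hthree : ∃ n u₁ u₂ u₃, Attached G (box d n) u₁ ∧ Attached G (box d n) u₂ ∧
      Attached G (box d n) u₃ ∧ ¬ (within G (box d n : Set (Fin d → ℤ))ᶜ).Reachable u₁ u₂ ∧
      ¬ (within G (box d n : Set (Fin d → ℤ))ᶜ).Reachable u₁ u₃ ∧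
      ¬ (within G (box d n : Set (Fin d → ℤ))ᶜ).Reachable u₂ u₃
  · obtain ⟨n, u₁, u₂, u₃, h1, h2, h3, h12, h13, h23⟩ := hthree
    obtain ⟨H, hH, r2, r3, hdeg⟩ := exists_subgraph_three
      (patch_reachable hG h1.exists_adj h2.exists_adj)
      (patch_reachable hG h3.exists_adj h1.exists_adj)
    refine ⟨box d n, H, hH, fun v _ => (hdeg v).trans (by exact_mod_cast hk), fun G' hG' => ?_⟩
    exact Or.inl (hG'.hasThreeEnds hG h1 h2 h3 h12 h13 h23 r2 r3)
  · have htwo : ∀ n u₁ u₂ u₃, Attached G (box d n) u₁ → Attached G (box d n) u₂ →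
        Attached G (box d n) u₃ → ¬ (within G (box d n : Set (Fin d → ℤ))ᶜ).Reachable u₁ u₂ →
        (within G (box d n : Set (Fin d → ℤ))ᶜ).Reachable u₁ u₃ ∨
        (within G (box d n : Set (Fin d → ℤ))ᶜ).Reachable u₂ u₃ := by
      intro n u₁ u₂ u₃ h1 h2 h3 h12
      by_contra! hcon
      exact hthree ⟨n, u₁, u₂, u₃, h1, h2, h3, h12, hcon.1, hcon.2⟩
    obtain ⟨x, y, hx, hy, hxy⟩ := h
    obtain ⟨n, hn⟩ := exists_subset_box {x, y}
    have hxn := hn n le_rfl (by simp : x ∈ ({x, y} : Finset (Fin d → ℤ)))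
    have hyn := hn n le_rfl (by simp : y ∈ ({x, y} : Finset (Fin d → ℤ)))
    obtain ⟨u₁, h1, r1⟩ := exists_attached hG hxn hx
    obtain ⟨u₂, h2, r2⟩ := exists_attached hG hyn hy
    obtain ⟨H, hH, hr, hdeg⟩ := exists_subgraph_two
      (patch_reachable hG h1.exists_adj h2.exists_adj)
    refine ⟨box d n, H, hH, fun v _ => (hdeg v).trans (by exact_mod_cast (by omega : 2 ≤ k)),
      fun G' hG' => Or.inr ?_⟩
    have hwle : ∀ m : ℕ, within G (box d m : Set (Fin d → ℤ))ᶜ ≤ G := fun m => within_le _ _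
    have h12 : ¬ (within G (box d n : Set (Fin d → ℤ))ᶜ).Reachable u₁ u₂ := fun h =>
      hxy ((r1.trans (h.mono (hwle n))).trans r2.symm)
    -- infinite clusters of `G` are those of `x` and `y`
    have hclass : ∀ p, {z | G.Reachable p z}.Infinite → G.Reachable p x ∨ G.Reachable p y := by
      intro p hp
      obtain ⟨m, hm⟩ := exists_subset_box {x, y, p}
      have hm := hm m le_rfl
      obtain ⟨v₁, g1, q1⟩ := exists_attached hG
        (hm (by simp : x ∈ ({x, y, p} : Finset (Fin d → ℤ)))) hx
      obtain ⟨v₂, g2, q2⟩ := exists_attached hG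
        (hm (by simp : y ∈ ({x, y, p} : Finset (Fin d → ℤ)))) hy
      obtain ⟨v₃, g3, q3⟩ := exists_attached hG
        (hm (by simp : p ∈ ({x, y, p} : Finset (Fin d → ℤ)))) hp
      rcases htwo m v₁ v₂ v₃ g1 g2 g3 fun h =>
        hxy ((q1.trans (h.mono (hwle m))).trans q2.symm) with h | h
      · exact Or.inl ((q3.trans (h.mono (hwle m)).symm).trans q1.symm)
      · exact Or.inr ((q3.trans (h.mono (hwle m)).symm).trans q2.symm)
    -- infinite clusters of `G'` contain `u₁`
    have key : ∀ p, {z | G'.Reachable p z}.Infinite → G'.Reachable p u₁ := by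
      intro p hp
      -- An infinite cluster of `G'` has an infinite part away from the box, where `G'` agrees with
      -- `G`. In `G` this part belongs to the cluster of `x` or `y`, so it reaches the box at an
      -- attached site. By `htwo` that site is joined off the box to `u₁` or `u₂`, and `H` links
      -- these two.
      obtain ⟨q, hqn, hpq, hinf, -⟩ := exists_infinite_within_compl
        (neighborSet_finite_of_le_lattice hG'.le_lattice) (nbhd_finite (box d n)) hp
      rw [hG'.within_nbhd_compl] at hinf
      refine hpq.trans ?_
      have hinfD : {z | (within G (box d n : Set (Fin d → ℤ))ᶜ).Reachable q z}.Infinite :=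
        hinf.mono fun z hz => hz.mono
          (within_mono le_rfl (compl_subset_compl.2 (subset_nbhd _)))
      have hqD : q ∉ box d n := fun h => hqn (subset_nbhd _ h)
      have hbox : ∃ w ∈ box d n, G.Reachable q w := by
        rcases hclass q (hinfD.mono fun z hz => hz.mono (hwle n)) with h | h
        · exact ⟨x, hxn, h⟩
        · exact ⟨y, hyn, h⟩
      obtain ⟨w, hw, hqw⟩ := hbox
      obtain ⟨u, c, hu, hc, huc, hru⟩ := exists_first_hit
        (s := (box d n : Set (Fin d → ℤ))) hqw hqD hw
      have hatt : Attached G (box d n) u := ⟨hu, hinfD.mono fun z hz => hru.symm.trans hz,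
        c, hc, huc⟩
      have hle := hG'.within_compl_le
      refine (hru.mono hle).trans ?_
      rcases htwo n u₁ u₂ u h1 h2 hatt h12 with h | h
      · exact (h.mono hle).symm
      · exact ((h.mono hle).symm).trans (hr.mono hG'.le).symm
    rintro ⟨p, q, hp, hq, hpq⟩
    exact hpq ((key p hp).trans (key q hq).symm)

/-- Were non-uniqueness possible, it would be almost sure by the zero-one law; but then both
outcomes of the rewiring would be null, against `surgery`. -/
theorem measure_nonUnique_of_three_le {k : ℕ} (hd : 1 ≤ d) (hk : 3 ≤ k) {t : unitInterval}
    (ht : 0 < t) : clockMeasure d {U | NonUnique (openGraph k U t)} = 0 := by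
  have hk1 : 1 ≤ k := by omega
  by_contra hne
  have hone : (clockMeasure d).real {U | NonUnique (openGraph k U t)} = 1 := by
    refine (measureReal_eq_zero_or_one_of_shift_invariant hd
      (nullMeasurableSet_nonUnique hk1 t) fun x => ?_).resolve_left fun h =>
      hne ((measureReal_eq_zero_iff (by finiteness)).1 h)
    ext U
    exact nonUnique_shift x
  have hcompl : clockMeasure d {U | ¬ NonUnique (openGraph k U t)} = 0 := by
    have h1 : clockMeasure d {U | NonUnique (openGraph k U t)} = 1 := by
      rw [measureReal_def] at hone
      rw [← ENNReal.ofReal_toReal (measure_ne_top (clockMeasure d) _), hone, ENNReal.ofReal_one]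
    exact (prob_compl_eq_zero_iff₀ (nullMeasurableSet_nonUnique hk1 t)).2 h1
  refine surgery hk1 ht (Q := fun G => HasThreeEnds G ∨ ¬ NonUnique G) hne
    (Filter.Eventually.of_forall fun U hU => NonUnique.exists_rewiring hk openGraph_le hU) ?_
  exact measure_union_null (measure_hasThreeEnds hk1 t) hcompl

/-! ### Constraint two: mass transport and the absence of endpoints. -/

/-- The site `x` is in an infinite cluster and has at most one neighbour. -/
def IsEndpoint {V : Type*} (G : SimpleGraph V) (x : V) : Prop :=
  {z | G.Reachable x z}.Infinite ∧ ∀ a b, G.Adj x a → G.Adj x b → a = b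

theorem nullMeasurableSet_isEndpoint {k : ℕ} (hk : 1 ≤ k) (t : unitInterval) (x : Fin d → ℤ) :
    NullMeasurableSet {U : Clocks d | IsEndpoint (openGraph k U t) x} (clockMeasure d) := by
  have : {U : Clocks d | IsEndpoint (openGraph k U t) x} = {U | (cluster k U t x).Infinite} ∩
      ⋂ a, ⋂ b, ⋂ _ : a ≠ b, ({U | (openGraph k U t).Adj x a} ∩ {U | (openGraph k U t).Adj x b})ᶜ := by
    ext U
    simp only [IsEndpoint, mem_inter_iff, mem_iInter, mem_compl_iff, mem_ofPred_eq]
    refine and_congr_right fun _ => forall₂_congr fun a b => ?_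
    tauto
  rw [this]
  exact (nullMeasurableSet_cluster_infinite hk t x).inter (.iInter fun a => .iInter fun b =>
    .iInter fun _ => ((nullMeasurableSet_adj hk t x a).inter (nullMeasurableSet_adj hk t x b)).compl)

theorem isEndpoint_shift {k : ℕ} {U : Clocks d} {t : unitInterval} {x v : Fin d → ℤ} :
    IsEndpoint (openGraph k (shift x U) t) v ↔ IsEndpoint (openGraph k U t) (v + x) := by
  refine and_congr cluster_shift_infinite ?_
  simp only [openGraph_shift_adj]
  constructor
  · intro h a b ha hb
    have := h (a - x) (b - x) (by simpa using ha) (by simpa using hb)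
    simpa using this
  · intro h a b ha hb
    simpa using h _ _ ha hb

/-- By the mass transport principle, infinite clusters in the model with constraint two have no
endpoints. -/
theorem measure_isEndpoint (t : unitInterval) (x : Fin d → ℤ) :
    clockMeasure d {U | IsEndpoint (openGraph 2 U t) x} = 0 := by
  suffices h0 : clockMeasure d {U | IsEndpoint (openGraph 2 U t) 0} = 0 by
    rw [← (measurePreserving_shift x).measure_preimage
      (nullMeasurableSet_isEndpoint one_le_two t 0)] at h0
    simpa only [preimage_ofPred_eq, isEndpoint_shift, zero_add] using h0
  set μ := clockMeasure d with hμ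
  -- If it is an endpoint, the origin sends unit mass to every site of its cluster. `F y` is the
  -- event that `y` receives it; the translate `F' y` is the event that the origin receives mass
  -- from `-y`.
  let F : (Fin d → ℤ) → Set (Clocks d) := fun y =>
    {U | IsEndpoint (openGraph 2 U t) 0} ∩ {U | (openGraph 2 U t).Reachable 0 y}
  let F' : (Fin d → ℤ) → Set (Clocks d) := fun y =>
    {U | IsEndpoint (openGraph 2 U t) (-y)} ∩ {U | (openGraph 2 U t).Reachable (-y) 0}
  have hr := fun v w => nullMeasurableSet_reachable (nullMeasurableSet_adj (d := d) one_le_two t) v w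
  have hF : ∀ y, NullMeasurableSet (F y) μ := fun y =>
    (nullMeasurableSet_isEndpoint one_le_two t 0).inter (hr 0 y)
  have hF' : ∀ y, NullMeasurableSet (F' y) μ := fun y =>
    (nullMeasurableSet_isEndpoint one_le_two t (-y)).inter (hr (-y) 0)
  have hFF' : ∀ y, μ (F y) = μ (F' y) := fun y => by
    rw [← (measurePreserving_shift (-y)).measure_preimage (hF y)]
    congr 1
    ext U
    simp [F, F', isEndpoint_shift, openGraph_shift_reachable]
  -- Two distinct endpoints in one cluster of maximal degree two would make it finite, so the origin
  -- receives at most unit mass.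
  have hdisj : Pairwise (Function.onFun (AEDisjoint μ) F') := by
    intro y y' hyy
    refine measure_mono_null_ae (t := ∅) ?_ measure_empty
    filter_upwards [ae_regular d] with U hU hmem
    obtain ⟨⟨⟨h1, h2⟩, h3⟩, ⟨h4, h5⟩, h6⟩ := hmem
    have hle : ∀ z, (∀ a b, (openGraph 2 U t).Adj z a → (openGraph 2 U t).Adj z b → a = b) →
        ((openGraph 2 U t).neighborSet z).encard ≤ 1 := fun z hz =>
      encard_le_one_iff.2 hz
    exact h1 (finite_of_two_endpoints (openGraph_degree_le one_le_two hU t)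
      (fun h => hyy (neg_injective h)) (h3.trans h6.symm) (hle _ h2) (hle _ h5))
  have hsum : ∑' y, μ (F y) ≤ 1 := by
    simp_rw [hFF']
    exact (tsum_meas_le_meas_iUnion_of_disjoint₀ μ hF' hdisj).trans prob_le_one
  have hint : ∫⁻ U, ∑' y, (F y).indicator 1 U ∂μ = ∑' y, μ (F y) := by
    rw [lintegral_tsum fun y => measurable_one.aemeasurable.indicator₀ (hF y)]
    simp_rw [lintegral_indicator_one₀ (hF _)]
  -- The mass sent has mean at most one, hence is almost surely finite, whereas it is infinite
  -- whenever the origin is an endpoint.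
  have hae := ae_lt_top' (μ := μ) (f := fun U => ∑' y, (F y).indicator (1 : Clocks d → ENNReal) U)
    (AEMeasurable.tsum fun y => measurable_one.aemeasurable.indicator₀ (hF y))
    (by rw [hint]; exact (hsum.trans_lt ENNReal.one_lt_top).ne)
  refine measure_mono_null ?_ hae
  intro U hU hlt
  have hlt : ∑' y, (F y).indicator (1 : Clocks d → ENNReal) U < ⊤ := hlt
  refine hlt.ne ?_
  have hset : ∀ y, (F y).indicator (1 : Clocks d → ENNReal) U =
      {y | (openGraph 2 U t).Reachable 0 y}.indicator 1 y := fun y => by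
    by_cases h : (openGraph 2 U t).Reachable 0 y
    · rw [indicator_of_mem (show U ∈ F y from ⟨hU, h⟩), indicator_of_mem (by exact h)]; rfl
    · rw [indicator_of_notMem (fun h' => h h'.2), indicator_of_notMem (by exact h)]
  simp_rw [hset]
  rw [← tsum_subtype]
  have : Infinite {y | (openGraph 2 U t).Reachable 0 y} := hU.1.to_subtype
  exact ENNReal.tsum_const_eq_top_of_ne_zero one_ne_zero

theorem ae_not_isEndpoint (d : ℕ) (t : unitInterval) :
    ∀ᵐ U ∂clockMeasure d, ∀ x, ¬ IsEndpoint (openGraph 2 U t) x :=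
  ae_all_iff.2 fun x => by
    rw [ae_iff]
    simpa using measure_isEndpoint t x

theorem lattice_adj_iff {x y : Fin d → ℤ} :
    (lattice d).Adj x y ↔ ∃ i, |x i - y i| = 1 ∧ ∀ j ≠ i, y j = x j := by
  constructor
  · intro h
    have hsum : ∑ i, |x i - y i| = 1 := h
    obtain ⟨i, -, hi⟩ := Finset.exists_ne_zero_of_sum_ne_zero (by rw [hsum]; exact one_ne_zero)
    have hsplit := Finset.add_sum_erase Finset.univ (fun i => |x i - y i|) (Finset.mem_univ i)
    have hnn : 0 ≤ ∑ j ∈ Finset.univ.erase i, |x j - y j| :=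
      Finset.sum_nonneg fun _ _ => abs_nonneg _
    have hi' : 0 < |x i - y i| := lt_of_le_of_ne (abs_nonneg _) (Ne.symm hi)
    refine ⟨i, by omega, fun j hj => ?_⟩
    have h0 : ∑ j ∈ Finset.univ.erase i, |x j - y j| = 0 := by omega
    have := (Finset.sum_eq_zero_iff_of_nonneg fun _ _ => abs_nonneg _).1 h0 j
      (Finset.mem_erase.2 ⟨hj, Finset.mem_univ j⟩)
    have := abs_eq_zero.1 this
    omega
  · rintro ⟨i, hi, h⟩
    change ∑ j, |x j - y j| = 1
    rw [Finset.sum_eq_single i (fun j _ hj => by simp [h j hj]) (by simp), hi]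

theorem lattice_adj_iff_of_eq {x y : Fin d → ℤ} {i : Fin d} (h : ∀ j ≠ i, y j = x j) :
    (lattice d).Adj x y ↔ |x i - y i| = 1 := by
  rw [lattice_adj_iff]
  refine ⟨?_, fun h' => ⟨i, h', h⟩⟩
  rintro ⟨j, hj, -⟩
  by_cases hji : j = i
  · rwa [← hji]
  · rw [h j hji] at hj
    simp at hj

/-- On the line, a site of an infinite cluster that is not an endpoint has both its edges open, so
the cluster spreads to every site. -/
theorem measure_nonUnique_one_two (t : unitInterval) :
    clockMeasure 1 {U | NonUnique (openGraph 2 U t)} = 0 := by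
  rw [measure_eq_zero_iff_ae_notMem]
  filter_upwards [ae_not_isEndpoint 1 t] with U hU
  rintro ⟨x, y, hx, -, hxy⟩
  refine hxy ?_
  have hL : (lattice 1).Reachable x y := (box_reachable (a := x ⊓ y) (b := x ⊔ y)
    ⟨inf_le_left, le_sup_left⟩ ⟨inf_le_right, le_sup_right⟩).mono (within_le _ _)
  have hL1 : ∀ {v w : Fin 1 → ℤ}, (lattice 1).Adj v w → |v 0 - w 0| = 1 := fun {v w} h => by
    have h : ∑ i, |v i - w i| = 1 := h
    simpa using h
  have key : ∀ {u v : Fin 1 → ℤ} (p : (lattice 1).Walk u v), (openGraph 2 U t).Reachable x u →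
      (openGraph 2 U t).Reachable x v := by
    intro u v p
    induction p with
    | nil => exact id
    | @cons u w v h p ih =>
      refine fun hu => ih (hu.trans (SimpleGraph.Adj.reachable ?_))
      have hend := hU u
      rw [IsEndpoint, not_and] at hend
      have := hend (hx.mono fun z hz => hu.symm.trans hz)
      push Not at this
      obtain ⟨a, b, ha, hb, hab⟩ := this
      have h1 := hL1 (openGraph_le ha)
      have h2 := hL1 (openGraph_le hb)
      have h3 := hL1 h
      have h4 : a 0 ≠ b 0 := fun h => hab (funext fun i => by rwa [Subsingleton.elim i 0])
      rw [abs_eq one_pos.le] at h1 h2 h3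
      by_cases hwa : w 0 = a 0
      · rwa [show w = a from funext fun i => by rwa [Subsingleton.elim i 0]]
      · rwa [show w = b from funext fun i => by rw [Subsingleton.elim i 0]; omega]
  obtain ⟨p⟩ := hL
  exact key p .rfl

/-! ### The trap: constraint two in dimension at least two. -/

/-- A spoke of the trap: `g` is a neighbour of the origin to be saturated. -/
def IsSpoke (i j : Fin d) (σ : ℤ) (g h : Fin d → ℤ) : Prop :=
  (lattice d).Adj g h ∧ (((lattice d).Adj g 0 ∧ g i = 0 ∧ ∀ l ≠ i, h l = g l) ∨
    (g = Pi.single i (-σ) ∧ ∀ l ≠ j, h l = g l))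

/-- A graph of maximal degree two in which all neighbours of the origin have degree two, except for
the one in direction `i` with sign `σ`. -/
def trap (i j : Fin d) (σ : ℤ) : SimpleGraph (Fin d → ℤ) where
  Adj x y := IsSpoke i j σ x y ∨ IsSpoke i j σ y x
  symm := ⟨fun _ _ h => h.symm⟩
  loopless := ⟨fun _ h => h.elim (fun h => h.1.ne rfl) fun h => h.1.ne rfl⟩

section Trap

variable {i j : Fin d} {σ : ℤ}

theorem IsSpoke.cases (hij : j ≠ i) {g h : Fin d → ℤ} (hs : IsSpoke i j σ g h) :
    ((lattice d).Adj g 0 ∧ g i = 0 ∧ (∀ l ≠ i, h l = g l) ∧ |h i| = 1) ∨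
    (g = Pi.single i (-σ) ∧ h i = -σ ∧ (∀ l ≠ j, h l = g l) ∧ |h j| = 1) := by
  rcases hs with ⟨hadj, ⟨h0, hi, hl⟩ | ⟨rfl, hl⟩⟩
  · left
    refine ⟨h0, hi, hl, ?_⟩
    have := (lattice_adj_iff_of_eq hl).1 hadj
    rw [hi] at this
    simpa using this
  · right
    refine ⟨rfl, by simpa using hl i hij.symm, hl, ?_⟩
    have := (lattice_adj_iff_of_eq hl).1 hadj
    simpa [hij] using this

/-- Centres orthogonal to direction `i` carry the two spokes along `i`; the centre opposite to `σ`
carries the two spokes along `j`. Any other site can be hit only from its projection to `v i = 0`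
and from the opposite centre. -/
theorem trap_encard_le_two (hσ : |σ| = 1) (hij : j ≠ i) (v : Fin d → ℤ) :
    ((trap i j σ).neighborSet v).encard ≤ 2 := by
  have hpair : ∀ a b : Fin d → ℤ, (trap i j σ).neighborSet v ⊆ {a, b} →
      ((trap i j σ).neighborSet v).encard ≤ 2 := fun a b h =>
    (encard_le_encard h).trans ((encard_insert_le _ _).trans (by rw [encard_singleton]; norm_num))
  have hσ0 : σ ≠ 0 := by rintro rfl; simp at hσ
  by_cases hvi : v i = 0
  · refine hpair (Function.update v i 1) (Function.update v i (-1)) ?_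
    rintro w (h | h)
    · rcases h.cases hij with ⟨-, -, hl, habs⟩ | ⟨rfl, -⟩
      · rcases (abs_eq one_pos.le).1 habs with h1 | h1
        · exact Or.inl (Function.eq_update_iff.2 ⟨h1, hl⟩)
        · exact Or.inr (Function.eq_update_iff.2 ⟨h1, hl⟩)
      · simp [hσ0] at hvi
    · rcases h.cases hij with ⟨-, -, -, habs⟩ | ⟨-, hi, -⟩
      · simp [hvi] at habs
      · omega
  by_cases hvE : v = Pi.single i (-σ)
  · refine hpair (Function.update v j 1) (Function.update v j (-1)) ?_
    rintro w (h | h)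
    · rcases h.cases hij with ⟨-, hi, -⟩ | ⟨-, -, hl, habs⟩
      · exact absurd hi hvi
      · rcases (abs_eq one_pos.le).1 habs with h1 | h1
        · exact Or.inl (Function.eq_update_iff.2 ⟨h1, hl⟩)
        · exact Or.inr (Function.eq_update_iff.2 ⟨h1, hl⟩)
    · rcases h.cases hij with ⟨h0, hi, hl, -⟩ | ⟨-, -, -, habs⟩
      · refine absurd (funext fun l => ?_) h0.ne
        by_cases hli : l = i
        · rw [hli, hi]; rfl
        · rw [← hl l hli, hvE]
          simp [hli]
      · simp [hvE, hij] at habs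
  · refine hpair (Function.update v i 0) (Pi.single i (-σ)) ?_
    rintro w (h | h)
    · rcases h.cases hij with ⟨-, hi, -⟩ | ⟨h, -⟩
      · exact absurd hi hvi
      · exact absurd h hvE
    · rcases h.cases hij with ⟨-, hi, hl, -⟩ | ⟨h, -⟩
      · exact Or.inl (Function.eq_update_iff.2 ⟨hi, fun l hli => (hl l hli).symm⟩)
      · exact Or.inr h

theorem abs_le_one_of_lattice_adj_zero {g : Fin d → ℤ} (h : (lattice d).Adj g 0) (l : Fin d) :
    |g l| ≤ 1 := by
  obtain ⟨m, hm, h⟩ := lattice_adj_iff.1 h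
  by_cases hl : l = m
  · rw [hl]; simpa using hm.le
  · rw [← h l hl]; simp

/-- The sites of the trap are close to the origin, and distinct from the origin and from its
neighbour in direction `i`. -/
theorem trap_adj (hσ : |σ| = 1) (hij : j ≠ i) {v w : Fin d → ℤ} (h : (trap i j σ).Adj v w) :
    (∀ l, |v l| ≤ 1) ∧ v ≠ 0 ∧ v ≠ Pi.single i σ := by
  have hσ0 : σ ≠ 0 := by rintro rfl; simp at hσ
  rcases h with h | h
  · rcases h.cases hij with ⟨h0, hi, -⟩ | ⟨rfl, -⟩
    · refine ⟨abs_le_one_of_lattice_adj_zero h0, h0.ne, ?_⟩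
      rintro rfl
      simp [hσ0] at hi
    · refine ⟨fun l => ?_, ?_, ?_⟩
      · by_cases hl : l = i
        · subst hl; simp [hσ]
        · simp [hl]
      · simpa using hσ0
      · intro h
        have := Pi.single_injective i h
        omega
  · rcases h.cases hij with ⟨h0, hi, hl, habs⟩ | ⟨rfl, hi, hl, habs⟩
    · refine ⟨fun l => ?_, ?_, ?_⟩
      · by_cases hli : l = i
        · rw [hli, habs]
        · rw [hl l hli]
          exact abs_le_one_of_lattice_adj_zero h0 l
      · rintro rfl
        simp at habs
      · rintro rfl
        refine h0.ne (funext fun l => ?_)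
        by_cases hli : l = i
        · rw [hli, hi]; rfl
        · rw [← hl l hli]; simp [hli]
    · refine ⟨fun l => ?_, ?_, ?_⟩
      · by_cases hlj : l = j
        · rw [hlj, habs]
        · rw [hl l hlj]
          by_cases hli : l = i
          · subst hli; simp [hσ]
          · simp [hli]
      · rintro rfl
        simp at habs
      · rintro rfl
        simp [hij] at habs

theorem trap_saturates (hσ : |σ| = 1) (hij : j ≠ i) {g : Fin d → ℤ} (hg : (lattice d).Adj 0 g)
    (hgE : g ≠ Pi.single i σ) : ∃ a b, a ≠ b ∧ (trap i j σ).Adj g a ∧ (trap i j σ).Adj g b := by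
  have hupd : ∀ (l : Fin d) (v : Fin d → ℤ), v l = 0 → Function.update v l 1 ≠
      Function.update v l (-1) ∧ (lattice d).Adj v (Function.update v l 1) ∧
      (lattice d).Adj v (Function.update v l (-1)) := by
    intro l v hv
    refine ⟨fun h => ?_, ?_, ?_⟩
    · have := congrFun h l
      simp at this
    · rw [lattice_adj_iff_of_eq (i := l) fun m hm => by simp [hm]]
      simp [hv]
    · rw [lattice_adj_iff_of_eq (i := l) fun m hm => by simp [hm]]
      simp [hv]
  by_cases hgi : g i = 0
  · obtain ⟨h1, h2, h3⟩ := hupd i g hgi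
    exact ⟨_, _, h1, Or.inl ⟨h2, Or.inl ⟨hg.symm, hgi, fun l hl => by simp [hl]⟩⟩,
      Or.inl ⟨h3, Or.inl ⟨hg.symm, hgi, fun l hl => by simp [hl]⟩⟩⟩
  · have hgs : g = Pi.single i (-σ) := by
      obtain ⟨l, hl, h⟩ := lattice_adj_iff.1 hg
      have hli : l = i := by
        by_contra hne
        exact hgi (by simpa using h i (Ne.symm hne))
      subst hli
      have heq : g = Pi.single l (g l) := by
        refine funext fun m => ?_
        by_cases hm : m = l
        · rw [hm]; simp
        · rw [h m hm]; simp [hm]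
      have hne : g l ≠ σ := fun h' => hgE (h' ▸ heq)
      have h1 : |g l| = 1 := by simpa using hl
      rw [heq]
      congr 1
      rw [abs_eq one_pos.le] at h1 hσ
      omega
    obtain ⟨h1, h2, h3⟩ := hupd j g (by rw [hgs]; simp [hij])
    exact ⟨_, _, h1, Or.inl ⟨h2, Or.inr ⟨hgs, fun l hl => by simp [hl]⟩⟩,
      Or.inl ⟨h3, Or.inr ⟨hgs, fun l hl => by simp [hl]⟩⟩⟩

end Trap

theorem exists_face {n : ℕ} {u z : Fin d → ℤ} (hu : u ∉ box d n) (hz : z ∈ box d n)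
    (h : (lattice d).Adj u z) : ∃ (i : Fin d) (σ : ℤ), |σ| = 1 ∧ n ≤ σ * u i ∧ z i = σ * n := by
  obtain ⟨i, hi, hl⟩ := lattice_adj_iff.1 h
  rw [mem_box] at hu hz
  have hui : ¬ (-(n : ℤ) ≤ u i ∧ u i ≤ n) := fun h' => hu fun l => by
    by_cases hli : l = i
    · rwa [hli]
    · rw [← hl l hli]; exact hz l
  have hzi := hz i
  rw [abs_eq one_pos.le] at hi
  rcases lt_or_ge (n : ℤ) (u i) with h' | h'
  · exact ⟨i, 1, by simp, by omega, by omega⟩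
  · exact ⟨i, -1, by simp, by omega, by omega⟩

/-- If the origin is in an infinite cluster, then in dimension at least two it can be turned into an
endpoint of an infinite cluster by a rewiring of maximal degree two. -/
theorem exists_rewiring_isEndpoint (hd : 2 ≤ d) {G : SimpleGraph (Fin d → ℤ)}
    (hG : G ≤ lattice d) (h0 : {y | G.Reachable 0 y}.Infinite) :
    ∃ (D : Finset (Fin d → ℤ)) (H : SimpleGraph (Fin d → ℤ)), H ≤ patch G D ∧
      (∀ v ∈ D, (H.neighborSet v).encard ≤ (2 : ℕ)) ∧
      ∀ G', Rewired 2 G H G' D → ∃ x, IsEndpoint G' x := by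
  -- Radius two suffices: the trap lives in radius one, and the outer layer is left for a path from
  -- the infinite part to the axis of direction `i`.
  have hmem0 : (0 : Fin d → ℤ) ∈ box d 2 := mem_box.2 fun i => by simp
  obtain ⟨u, hu, -⟩ := exists_attached hG hmem0 h0
  obtain ⟨z, hz, huz⟩ := hu.exists_adj
  obtain ⟨i, σ, hσ, hui, hzi⟩ := exists_face hu.notMem hz (hG huz)
  obtain ⟨j, hij⟩ : ∃ j, j ≠ i := by
    have : Nontrivial (Fin d) := Fin.nontrivial_iff_two_le.2 hd
    exact exists_ne i
  have hσσ : σ * σ = 1 := by rw [← abs_mul_abs_self, hσ, one_mul]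
  push_cast at hui hzi
  -- Territory reserved for the path to the origin. The trap avoids it, so at each site only one of
  -- the two degree bounds is needed.
  set S : Set (Fin d → ℤ) := {v | 2 ≤ σ * v i} ∪ {Pi.single i σ, 0} with hS
  have hSE : Pi.single i σ ∈ S := Or.inr (by simp)
  have hS0 : (0 : Fin d → ℤ) ∈ S := Or.inr (by simp)
  have hbE : ∀ c : ℤ, |c| ≤ 2 → (Pi.single i c : Fin d → ℤ) ∈ box d 2 := fun c hc =>
    mem_box.2 fun l => by
      rw [abs_le] at hc
      by_cases hl : l = i
      · subst hl; simpa using hc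
      · simp [hl]
  have hS2 : Pi.single i (σ * 2) ∈ S := Or.inl (by simp [← mul_assoc, hσσ])
  have hb2 := hbE (σ * 2) (by rw [abs_mul, hσ]; norm_num)
  have hb1 := hbE σ (by rw [hσ]; norm_num)
  have hzS : z ∈ S := Or.inl (by rw [mem_ofPred_eq, hzi, ← mul_assoc, hσσ]; norm_num)
  have huS : u ∈ S := Or.inl hui
  have huz' : (within (patch G (box d 2)) S).Adj u z :=
    ⟨⟨hG huz, Or.inr ⟨huz, Or.inr hz⟩⟩, huS, hzS⟩
  -- The path moves inside the face `v i = 2σ`, a degenerate box, to the axis, and then inwards to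
  -- the origin.
  have hzE : (within (patch G (box d 2)) S).Reachable z (Pi.single i (σ * 2)) := by
    have hle : within (lattice d) (Icc (Function.update (fun _ => -2) i (σ * 2))
        (Function.update (fun _ => 2) i (σ * 2))) ≤ within (patch G (box d 2)) S := by
      have hsub : ∀ v ∈ Icc (Function.update (fun _ => -2) i (σ * 2))
        (Function.update (fun _ => 2) i (σ * 2)), v ∈ box d 2 ∧ v ∈ S := by
        rintro v ⟨h1, h2⟩
        have hvi : v i = σ * 2 := le_antisymm (by simpa using h2 i) (by simpa using h1 i)
        refine ⟨mem_box.2 fun l => ?_, Or.inl ?_⟩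
        · by_cases hl : l = i
          · rw [hl, hvi]
            have : |σ * 2| ≤ 2 := by rw [abs_mul, hσ]; norm_num
            exact_mod_cast abs_le.1 this
          · have := h1 l
            have := h2 l
            simp_all
        · rw [mem_ofPred_eq, hvi, ← mul_assoc, hσσ]; norm_num
      intro v w h
      exact ⟨⟨h.1, Or.inl ⟨(hsub v h.2.1).1, (hsub w h.2.2).1⟩⟩, (hsub v h.2.1).2,
        (hsub w h.2.2).2⟩
    refine SimpleGraph.Reachable.mono hle (box_reachable ?_ ?_)
    · rw [mem_box] at hz
      constructor <;> intro l <;> by_cases hl : l = i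
      · subst hl; simp [hzi]
      · simpa [hl] using (hz l).1
      · subst hl; simp [hzi]
      · simpa [hl] using (hz l).2
    · constructor <;> intro l <;> by_cases hl : l = i
      · subst hl; simp
      · simp [hl]
      · subst hl; simp
      · simp [hl]
  have hE2 : (within (patch G (box d 2)) S).Adj (Pi.single i (σ * 2)) (Pi.single i σ) := by
    refine ⟨⟨?_, Or.inl ⟨hb2, hb1⟩⟩, hS2, hSE⟩
    rw [lattice_adj_iff_of_eq (i := i) fun l hl => by simp [hl]]
    simp only [Pi.single_eq_same]
    rw [show σ * 2 - σ = σ by ring, hσ]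
  have hE0 : (within (patch G (box d 2)) S).Adj (Pi.single i σ) 0 := by
    refine ⟨⟨?_, Or.inl ⟨hb1, hmem0⟩⟩, hSE, hS0⟩
    rw [lattice_adj_iff_of_eq (i := i) fun l hl => by simp [hl]]
    simpa using hσ
  have hu0 := (huz'.reachable.trans hzE).trans (hE2.reachable.trans hE0.reachable)
  obtain ⟨H₁, hH₁, hr, hdeg⟩ := exists_subgraph_two hu0
  have htrap : ∀ {v w}, (trap i j σ).Adj v w → v ∉ S := by
    rintro v w h (hv | hv | hv)
    · have h1 := (trap_adj hσ hij h).1 i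
      have h2 : σ * v i ≤ 1 := (le_abs_self _).trans (by rw [abs_mul, hσ, one_mul]; exact h1)
      have h3 : 2 ≤ σ * v i := hv
      omega
    · exact (trap_adj hσ hij h).2.2 hv
    · exact (trap_adj hσ hij h).2.1 hv
  refine ⟨box d 2, H₁ ⊔ trap i j σ, sup_le (hH₁.trans (within_le _ _)) ?_, fun v _ => ?_,
    fun G' hG' => ⟨0, ?_, ?_⟩⟩
  · intro v w h
    have hbox : ∀ {v w}, (trap i j σ).Adj v w → v ∈ box d 2 := fun {v w} h =>
      mem_box.2 fun l => by
        have := abs_le.1 ((trap_adj hσ hij h).1 l)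
        push_cast
        omega
    exact ⟨h.elim (fun h => h.1) fun h => h.1.symm, Or.inl ⟨hbox h, hbox h.symm⟩⟩
  · by_cases hv : v ∈ S
    · refine (encard_le_encard ?_).trans (hdeg v)
      rintro w (h | h)
      · exact h
      · exact absurd hv (htrap h)
    · refine (encard_le_encard ?_).trans (trap_encard_le_two hσ hij v)
      rintro w (h | h)
      · exact absurd (hH₁ h).2.1 hv
      · exact h
  · have h1 : G'.Reachable u 0 := hr.mono (le_sup_left.trans hG'.le)
    exact hu.infinite.mono fun y hy => h1.symm.trans (hy.mono hG'.within_compl_le)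
  -- Any other neighbour of the origin already has two trap edges, so an edge to the origin would
  -- give it degree three.
  · have key : ∀ g, G'.Adj 0 g → g = Pi.single i σ := by
      intro g hg
      by_contra hne
      obtain ⟨a, b, hab, ha, hb⟩ := trap_saturates hσ hij (hG'.le_lattice hg) hne
      have ha0 := (trap_adj hσ hij ha.symm).2.1
      have hb0 := (trap_adj hσ hij hb.symm).2.1
      have hsub : ({0, a, b} : Set (Fin d → ℤ)) ⊆ G'.neighborSet g := by
        rintro w (rfl | rfl | rfl)
        · exact hg.symm
        · exact hG'.le (Or.inr ha)
        · exact hG'.le (Or.inr hb)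
      have h3 := (encard_le_encard hsub).trans (hG'.degree_le g)
      rw [encard_insert_of_notMem (by simp [ha0.symm, hb0.symm]), encard_pair hab] at h3
      norm_num at h3
    intro a b ha hb
    rw [key a ha, key b hb]

theorem measure_infinite_two (hd : 2 ≤ d) {t : unitInterval} (ht : 0 < t) :
    clockMeasure d {U | (cluster 2 U t 0).Infinite} = 0 := by
  by_contra hne
  refine surgery one_le_two ht (Q := fun G => ∃ x, IsEndpoint G x) hne
    (.of_forall fun U hU => exists_rewiring_isEndpoint hd openGraph_le hU) ?_
  rw [measure_eq_zero_iff_ae_notMem]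
  filter_upwards [ae_not_isEndpoint d t] with U hU
  exact fun ⟨x, hx⟩ => hU x hx

/-! ### Degenerate cases and the lower bound on connectivity. -/

theorem measure_infinite_zero {k : ℕ} : clockMeasure d {U | (cluster k U 0 0).Infinite} = 0 := by
  rw [measure_eq_zero_iff_ae_notMem]
  filter_upwards [ae_mem_Ioo d] with U hU hinf
  refine hinf ((finite_singleton 0).subset ?_)
  rintro y ⟨p⟩
  cases p with
  | nil => rfl
  | cons h p =>
    obtain ⟨hl, O, -, -, h⟩ := openGraph_adj_iff.1 h
    exact absurd (hU (mkEdge hl)).1 (not_lt.2 h)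

/-- With constraint one the open edges form a matching. -/
theorem measure_infinite_one (t : unitInterval) :
    clockMeasure d {U | (cluster 1 U t 0).Infinite} = 0 := by
  rw [measure_eq_zero_iff_ae_notMem]
  filter_upwards [ae_regular d] with U hU hinf
  have hdeg := openGraph_degree_le le_rfl hU t
  have hone : ∀ v a b, (openGraph 1 U t).Adj v a → (openGraph 1 U t).Adj v b → a = b :=
    fun v => encard_le_one_iff.1 (by exact_mod_cast hdeg v)
  refine hinf (((finite_singleton 0).union (finite_of_encard_le_coe (hdeg 0))).subset ?_)
  rintro y ⟨p⟩
  suffices ∀ {v}, (openGraph 1 U t).Walk v y → v = 0 ∨ (openGraph 1 U t).Adj 0 v →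
      y = 0 ∨ (openGraph 1 U t).Adj 0 y from this p (Or.inl rfl)
  intro v p
  induction p with
  | nil => exact id
  | @cons v w y h p ih =>
    rintro (rfl | h')
    · exact ih p (Or.inr h)
    · exact ih p (Or.inl (hone _ _ _ h h'.symm))

theorem measure_nonUnique {k : ℕ} (hk : 2 ≤ k) (hd : 1 ≤ d) {t : unitInterval} (ht : 0 < t)
    (hθ : clockMeasure d {U | (cluster k U t 0).Infinite} ≠ 0) :
    clockMeasure d {U | NonUnique (openGraph k U t)} = 0 := by
  rcases hk.eq_or_lt with rfl | hk
  · rcases hd.eq_or_lt with rfl | hd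
    · exact measure_nonUnique_one_two t
    · exact absurd (measure_infinite_two hd ht) hθ
  · exact measure_nonUnique_of_three_le hd hk ht

/-- Inside a box containing both sites, a path has maximal degree two, so surgery can insert it
whatever the configuration. -/
theorem tau_pos {k : ℕ} (hk : 2 ≤ k) {t : unitInterval} (ht : 0 < t) (x y : Fin d → ℤ) :
    0 < tau d k t x y := by
  have h := surgery (d := d) (P := univ) (Q := fun G => G.Reachable x y) (by omega : 1 ≤ k) ht
    (by simp) (.of_forall fun U _ => ?_)
  · rw [tau, measureReal_def]
    exact ENNReal.toReal_pos h (measure_ne_top _ _)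
  obtain ⟨n, hn⟩ := exists_subset_box {x, y}
  have hsub := hn n le_rfl
  have hle : within (lattice d) (box d n : Set (Fin d → ℤ)) ≤ patch (openGraph k U t) (box d n) :=
    fun a b hab => ⟨hab.1, Or.inl hab.2⟩
  have hr : (within (lattice d) (box d n : Set (Fin d → ℤ))).Reachable x y := by
    rw [box, Finset.coe_Icc]
    apply box_reachable <;> rw [← Finset.coe_Icc] <;> exact hsub (by simp)
  obtain ⟨H, hH, hxy, hdeg⟩ := exists_subgraph_two (hr.mono hle)
  exact ⟨box d n, H, hH, fun v _ => (hdeg v).trans (by exact_mod_cast hk),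
    fun G' hG' => hxy.mono hG'.le⟩

theorem tau_eq {k : ℕ} (hk : 1 ≤ k) (t : unitInterval) (x y : Fin d → ℤ) :
    tau d k t x y = tau d k t 0 (y - x) := by
  have h := (measurePreserving_shift x).measureReal_preimage
    (nullMeasurableSet_reachable (nullMeasurableSet_adj (d := d) hk t) 0 (y - x))
  simp only [preimage_ofPred_eq, openGraph_shift_reachable, zero_add, sub_add_cancel] at h
  exact h

/-- By mixing and uniqueness, the connectivity function is bounded from below off a finite set. -/
theorem finite_tau_lt {k : ℕ} (hk : 1 ≤ k) {t : unitInterval} (hθ : 0 < theta d k t)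
    (h : clockMeasure d {U | NonUnique (openGraph k U t)} = 0) :
    {y | tau d k t 0 y < theta d k t ^ 2 / 2}.Finite := by
  have hA := nullMeasurableSet_cluster_infinite (d := d) hk t 0
  refine (mixing hA hA (by positivity : 0 < theta d k t ^ 2 / 2)).subset fun y hy => ?_
  rw [mem_ofPred_eq] at hy ⊢
  -- By uniqueness, two sites in infinite clusters are connected. If `τ_t(0,y) < θ²/2`, the joint
  -- probability then differs from `θ²` by at least `θ²/2`, which mixing allows for finitely many
  -- `y` only.
  have hle : (clockMeasure d).real ({U | (cluster k U t 0).Infinite} ∩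
      shift y ⁻¹' {U | (cluster k U t 0).Infinite}) ≤ tau d k t 0 y := by
    refine ENNReal.toReal_mono (measure_ne_top _ _) (measure_mono_ae ?_)
    filter_upwards [measure_eq_zero_iff_ae_notMem.1 h] with U hU hmem
    by_contra hcon
    refine hU ⟨0, y, hmem.1, ?_, hcon⟩
    have := cluster_shift_infinite.1 hmem.2
    rwa [zero_add] at this
  rw [← theta]
  refine le_trans ?_ (neg_le_abs _)
  nlinarith

/-- By translation only pairs `(0, y)` matter: off a finite set `θ²/2` is a lower bound, and on that
set the least value is positive by surgery. -/
theorem iInf_tau_pos {k : ℕ} (hk : 2 ≤ k) (hd : 1 ≤ d) {t : unitInterval} (ht : 0 < t)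
    (hθ : 0 < theta d k t) : 0 < ⨅ p : (Fin d → ℤ) × (Fin d → ℤ), tau d k t p.1 p.2 := by
  have hθ0 : clockMeasure d {U | (cluster k U t 0).Infinite} ≠ 0 := fun h0 => by
    rw [theta, measureReal_def, h0] at hθ
    exact hθ.ne rfl
  have hfin := finite_tau_lt (by omega : 1 ≤ k) hθ (measure_nonUnique hk hd ht hθ0)
  obtain ⟨c, hc, hcle⟩ : ∃ c, 0 < c ∧ ∀ y ∈ {y | tau d k t 0 y < theta d k t ^ 2 / 2},
      c ≤ tau d k t 0 y := by
    rcases eq_empty_or_nonempty {y | tau d k t 0 y < theta d k t ^ 2 / 2} with h | h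
    · exact ⟨1, one_pos, by simp [h]⟩
    · obtain ⟨z, -, hz⟩ := exists_min_image _ (tau d k t 0) hfin h
      exact ⟨_, tau_pos hk ht 0 z, hz⟩
  refine lt_of_lt_of_le (lt_min hc (by positivity : 0 < theta d k t ^ 2 / 2)) (le_ciInf fun p => ?_)
  rw [tau_eq (by omega : 1 ≤ k)]
  by_cases h : tau d k t 0 (p.2 - p.1) < theta d k t ^ 2 / 2
  · exact (min_le_left _ _).trans (hcle _ h)
  · exact (min_le_right _ _).trans (not_lt.1 h)

end CDP

/-- Constrained-degree percolation on `𝕃^d` with constraint `1 ≤ k ≤ 2d`: if `θ(t) > 0`, then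
the infimum over all pairs of sites of the two-point connectivity at time `t` is positive. -/
theorem theorem2 (d k : ℕ) (hk : 1 ≤ k) (hkd : k ≤ 2 * d) (t : unitInterval)
    (hθ : 0 < CDP.theta d k t) :
    0 < ⨅ p : (Fin d → ℤ) × (Fin d → ℤ), CDP.tau d k t p.1 p.2 := by
  have hne : CDP.clockMeasure d {U | (CDP.cluster k U t 0).Infinite} ≠ 0 := fun h0 => by
    rw [CDP.theta, measureReal_def, h0] at hθ
    exact hθ.ne rfl
  rcases (unitInterval.nonneg t).eq_or_lt with h | ht
  · obtain rfl : t = 0 := Subtype.ext h.symm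
    exact absurd CDP.measure_infinite_zero hne
  rcases hk.eq_or_lt with rfl | hk
  · exact absurd (CDP.measure_infinite_one t) hne
  -- The bound `k ≤ 2d` enters only through `1 ≤ d`.
  exact CDP.iInf_tau_pos hk (by omega) (by exact_mod_cast ht) hθ
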